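/- Let $d\ge 1$ and let $X^{(1)},X^{(2)},\dots$ be i.i.d. random vectors in $\mathbb R^d$, each with independent Exponential$(1)$ coordinates. For $x,y\in\mathbb R^d$ write $x\prec y$ if $x_j<y_j$ for all $1\le j\le d$, and put $x_+:=\sum_{j=1}^d x_j$. For $n\ge1$ let $$\mathrm{RS}_n:=\{x\in[0,\infty)^d:\ x\not\prec X^{(i)}\text{ for all }1\le i\le n\},$$ let the frontier $F_n$ be the topological boundary of $\mathrm{RS}_n$ relative to $[0,\infty)^d$, and let $F_n^-:=\min\{x_+:x\in F_n\}$, $F_n^+:=\max\{x_+:x\in F_n\}$ (almost surely, this minimum and this maximum exist for every $n\ge1$) and $W_n:=F_n^+-F_n^-$. Then: (a) $\displaystyle \frac{W_n}{\ln\ln n}\to d-1$ in probability as $n\to\infty$. (b) If $d\ge2$, then almost surely $$\liminf_{n\to\infty}\frac{W_n}{\ln\ln n}=d-1<d=\limsup_{n\to\infty}\frac{W_n}{\ln\ln n},$$ and, in particular, $W_n=\Theta(\ln\ln n)$ almost surely. -/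

import Mathlib

open MeasureTheory ProbabilityTheory Filter Topology Asymptotics

/-- Strict coordinatewise domination: `x_j < y_j` for every coordinate `j`. -/
def StrictDom {d : ℕ} (x y : Fin d → ℝ) : Prop := ∀ j, x j < y j

/-- The sum of coordinates `x_+`. -/
def coordSum {d : ℕ} (x : Fin d → ℝ) : ℝ := ∑ j, x j

/-- The closed positive orthant of `ℝ^d`. -/
def orthant (d : ℕ) : Set (Fin d → ℝ) := {z | ∀ j, 0 ≤ z j}

/-- The closed record-setting region after the first `n` observations. Observations are indexed
from `0`, so the first `n` of them are `x 0, …, x (n - 1)`. -/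
def recordRegion {d : ℕ} (x : ℕ → Fin d → ℝ) (n : ℕ) : Set (Fin d → ℝ) :=
  {z | z ∈ orthant d ∧ ∀ i < n, ¬ StrictDom z (x i)}

/-- The frontier `F_n`: the topological boundary of the record-setting region relative to the
closed positive orthant, i.e. taken in the subspace topology of the orthant, and then viewed as a
set of points of `ℝ^d`. -/
def recordFrontier {d : ℕ} (x : ℕ → Fin d → ℝ) (n : ℕ) : Set (Fin d → ℝ) :=
  Subtype.val '' frontier (Subtype.val ⁻¹' recordRegion x n : Set (orthant d))

/-- `F_n^-`, the least coordinate sum on the frontier. -/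
noncomputable def frontierMin {d : ℕ} (x : ℕ → Fin d → ℝ) (n : ℕ) : ℝ :=
  sInf (coordSum '' recordFrontier x n)

/-- `F_n^+`, the greatest coordinate sum on the frontier. -/
noncomputable def frontierMax {d : ℕ} (x : ℕ → Fin d → ℝ) (n : ℕ) : ℝ :=
  sSup (coordSum '' recordFrontier x n)

/-- The width `W_n = F_n^+ - F_n^-` of the frontier. -/
noncomputable def frontierWidth {d : ℕ} (x : ℕ → Fin d → ℝ) (n : ℕ) : ℝ :=
  frontierMax x n - frontierMin x n

/-! ### Deterministic geometry of the frontier. -/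

section Geometry

variable {d : ℕ}

/-! Both extremes of the frontier are `log n` plus a multiple of `log (log n)`. The maximum `F_n^+`
is the largest coordinate sum of an observation, and `F_n^-` is the least coordinate sum over the
whole record-setting region. For `d ≥ 2` the coefficient for `F_n^-` tends to 0 almost surely. The
coefficient for `F_n^+` tends to `d - 1` in probability, with almost sure liminf `d - 1` and limsup
`d`. For `d = 1` the width vanishes.

For `F_n^+`: a coordinate sum exceeds `x` with probability of order `x ^ (d - 1) * exp (-x)`, so
about `(log n) ^ (d - 1 - c)` of `n` observations are expected above `log n + c * log (log n)`. This
gives the limit in probability, and Borel–Cantelli along `n = 2 ^ k` gives the almost sure bounds,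
the upper one needing `c > d`. At `c = d` the `n`-th observation alone exceeds the level with
probability at least of order `1 / (n log n)`. That series diverges, so the limsup is attained.

For `F_n^-`: a point `z` is dominated by one observation with probability `exp (-coordSum z)`.
Slightly below `log n`, all points of a polylogarithmic grid are dominated
(`ae_eventually_le_frontierMin`). Slightly above, well-separated points of a simplex are almost
independent and cannot all be dominated (`ae_eventually_frontierMin_le`). -/

lemma continuous_coordSum : Continuous (coordSum : (Fin d → ℝ) → ℝ) := by
  unfold coordSum; fun_prop

lemma coordSum_mono {x y : Fin d → ℝ} (h : ∀ j, x j ≤ y j) : coordSum x ≤ coordSum y :=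
  Finset.sum_le_sum fun j _ => h j

lemma le_coordSum {x : Fin d → ℝ} (h : x ∈ orthant d) (j : Fin d) : x j ≤ coordSum x :=
  Finset.single_le_sum (f := x) (fun i _ => h i) (Finset.mem_univ j)

lemma isClosed_orthant : IsClosed (orthant d) := by
  simp only [orthant, Set.ofPred_forall]
  exact isClosed_iInter fun j => isClosed_le continuous_const (continuous_apply j)

lemma isClosed_recordRegion (x : ℕ → Fin d → ℝ) (n : ℕ) : IsClosed (recordRegion x n) := by
  have : recordRegion x n = orthant d ∩ ⋂ i, ⋂ (_ : i < n), ⋃ j, {z | x i j ≤ z j} := by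
    ext z
    simp [recordRegion, StrictDom]
  rw [this]
  refine isClosed_orthant.inter (isClosed_iInter fun i => isClosed_iInter fun _ =>
    isClosed_iUnion_of_finite fun j => isClosed_le continuous_const (continuous_apply j))

/-- For observations with positive coordinates, the frontier consists of the points of the
record-setting region lying weakly below some observation. -/
lemma mem_recordFrontier_iff {x : ℕ → Fin d → ℝ} (hx : ∀ i j, 0 < x i j) {n : ℕ}
    {z : Fin d → ℝ} :
    z ∈ recordFrontier x n ↔ z ∈ recordRegion x n ∧ ∃ i < n, ∀ j, z j ≤ x i j := by
  have hcl : IsClosed (Subtype.val ⁻¹' recordRegion x n : Set (orthant d)) :=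
    (isClosed_recordRegion x n).preimage continuous_subtype_val
  rw [recordFrontier, hcl.frontier_eq]
  constructor
  · rintro ⟨w, ⟨hw, hint⟩, rfl⟩
    refine ⟨hw, ?_⟩
    by_contra! hcon
    apply hint
    rw [mem_interior]
    refine ⟨Subtype.val ⁻¹' (⋂ i ∈ Finset.range n, ⋃ j, {z : Fin d → ℝ | x i j < z j}), ?_, ?_, ?_⟩
    · intro v hv
      simp only [Set.mem_preimage, Set.mem_iInter, Finset.mem_range, Set.mem_iUnion,
        Set.mem_ofPred_eq] at hv
      refine ⟨v.2, fun i hi hdom => ?_⟩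
      obtain ⟨j, hj⟩ := hv i hi
      exact absurd (hdom j) hj.le.not_gt
    · refine IsOpen.preimage continuous_subtype_val (isOpen_biInter_finset fun i _ =>
        isOpen_iUnion fun j => isOpen_lt continuous_const (continuous_apply j))
    · simpa using hcon
  · rintro ⟨hz, i, hi, hle⟩
    refine ⟨⟨z, hz.1⟩, ⟨hz, fun hint => ?_⟩, rfl⟩
    -- Shrinking `z` towards the origin puts it strictly below `x i`, hence outside the region. The
    -- `max 0` keeps the path in the orthant for every real `s`.
    let f : ℝ → orthant d := fun s =>
      ⟨fun j => max 0 (1 - s) * z j, fun j => mul_nonneg (le_max_left _ _) (hz.1 j)⟩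
    have hf : Continuous f := by
      refine Continuous.subtype_mk ?_ _
      fun_prop
    have hf0 : f 0 = ⟨z, hz.1⟩ := by
      ext j
      simp [f]
    have hmem : ∀ᶠ s in 𝓝[>] (0 : ℝ), f s ∈ interior (Subtype.val ⁻¹' recordRegion x n) := by
      refine nhdsWithin_le_nhds (hf.continuousAt.eventually_mem ?_)
      rw [hf0]
      exact isOpen_interior.mem_nhds hint
    obtain ⟨s, hs, hs0⟩ := (hmem.and self_mem_nhdsWithin).exists
    refine (interior_subset hs).2 i hi fun j => ?_
    change max 0 (1 - s) * z j < x i j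
    have h1 : max 0 (1 - s) < 1 := max_lt one_pos (by linarith)
    calc max 0 (1 - s) * z j ≤ max 0 (1 - s) * x i j :=
          mul_le_mul_of_nonneg_left (hle j) (le_max_left _ _)
      _ < 1 * x i j := mul_lt_mul_of_pos_right h1 (hx i j)
      _ = x i j := one_mul _

/-- The greatest coordinate sum on the frontier is the greatest coordinate sum of an
observation. -/
lemma exists_isGreatest_recordFrontier {x : ℕ → Fin d → ℝ} (hd : 1 ≤ d)
    (hx : ∀ i j, 0 < x i j) {n : ℕ} (hn : 1 ≤ n) :
    ∃ i < n, IsGreatest (coordSum '' recordFrontier x n) (coordSum (x i)) ∧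
      ∀ k < n, coordSum (x k) ≤ coordSum (x i) := by
  have : Nonempty (Fin d) := ⟨⟨0, hd⟩⟩
  obtain ⟨i, hi, hmax⟩ := (Finset.range n).exists_max_image (fun k => coordSum (x k))
    ⟨0, by simp; omega⟩
  simp only [Finset.mem_range] at hi hmax
  refine ⟨i, hi, ⟨⟨x i, ?_, rfl⟩, ?_⟩, hmax⟩
  · rw [mem_recordFrontier_iff hx]
    refine ⟨⟨fun j => (hx i j).le, fun k hk hdom => ?_⟩, i, hi, fun j => le_rfl⟩
    exact absurd (hmax k hk) (not_le.2 (Finset.sum_lt_sum_of_nonempty Finset.univ_nonempty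
      fun j _ => hdom j))
  · rintro _ ⟨z, hz, rfl⟩
    obtain ⟨-, k, hk, hle⟩ := (mem_recordFrontier_iff hx).1 hz
    exact (coordSum_mono hle).trans (hmax k hk)

/-- The least coordinate sum on the frontier is the least coordinate sum over the whole
record-setting region. -/
lemma exists_isLeast_recordFrontier {x : ℕ → Fin d → ℝ} (hd : 1 ≤ d)
    (hx : ∀ i j, 0 < x i j) {n : ℕ} (hn : 1 ≤ n) :
    ∃ z ∈ recordRegion x n, IsLeast (coordSum '' recordFrontier x n) (coordSum z) ∧
      ∀ w ∈ recordRegion x n, coordSum z ≤ coordSum w := by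
  obtain ⟨i, hi, ⟨hiF, -⟩, -⟩ := exists_isGreatest_recordFrontier hd hx hn
  obtain ⟨y, hyF, -⟩ := hiF
  have hy := ((mem_recordFrontier_iff hx).1 hyF).1
  -- The region is unbounded; cutting it at the level of a known frontier point gives compactness
  -- without losing the minimum.
  have hcomp : IsCompact (recordRegion x n ∩ {z | coordSum z ≤ coordSum y}) := by
    refine Metric.isCompact_of_isClosed_isBounded ((isClosed_recordRegion x n).inter
      (isClosed_le continuous_coordSum continuous_const)) ?_
    refine (Metric.isBounded_Icc (0 : Fin d → ℝ) (fun _ => coordSum y)).subset ?_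
    rintro z ⟨hz, hzy⟩
    exact ⟨fun j => hz.1 j, fun j => (le_coordSum hz.1 j).trans hzy⟩
  obtain ⟨z, ⟨hz, hzy⟩, hmin⟩ := hcomp.exists_isMinOn ⟨y, hy, le_refl (coordSum y)⟩
    continuous_coordSum.continuousOn
  have hmin' : ∀ w ∈ recordRegion x n, coordSum z ≤ coordSum w := by
    intro w hw
    rcases le_total (coordSum w) (coordSum y) with h | h
    · exact hmin ⟨hw, h⟩
    · exact le_trans hzy h
  refine ⟨z, hz, ⟨⟨z, ?_, rfl⟩, ?_⟩, hmin'⟩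
  · rw [mem_recordFrontier_iff hx]
    refine ⟨hz, ?_⟩
    -- A minimiser strictly beyond every observation in some coordinate could be scaled down inside
    -- the region, lowering its positive sum.
    by_contra! hcon
    have hpos : 0 < coordSum z := by
      obtain ⟨j, hj⟩ := hcon 0 (by omega)
      exact ((hx 0 j).trans hj).trans_le (le_coordSum hz.1 j)
    have hopen : IsOpen (⋂ i ∈ Finset.range n, ⋃ j, {z : Fin d → ℝ | x i j < z j}) :=
      isOpen_biInter_finset fun i _ =>
        isOpen_iUnion fun j => isOpen_lt continuous_const (continuous_apply j)
    have hf : Continuous fun s : ℝ => (1 - s) • z := by fun_prop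
    have hev : ∀ᶠ s in 𝓝[>] (0 : ℝ), (1 - s) • z ∈
        (⋂ i ∈ Finset.range n, ⋃ j, {z : Fin d → ℝ | x i j < z j}) := by
      refine nhdsWithin_le_nhds (hf.continuousAt.eventually_mem (hopen.mem_nhds ?_))
      simpa using hcon
    obtain ⟨s, hs, hs0, hs1⟩ := (hev.and (Ioo_mem_nhdsGT (zero_lt_one (α := ℝ)))).exists
    simp only [Set.mem_iInter, Finset.mem_range, Set.mem_iUnion, Set.mem_ofPred_eq] at hs
    have hw : (1 - s) • z ∈ recordRegion x n := by
      refine ⟨fun j => mul_nonneg (by linarith) (hz.1 j), fun i hi hdom => ?_⟩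
      obtain ⟨j, hj⟩ := hs i hi
      exact absurd (hdom j) hj.le.not_gt
    have h1 := hmin' _ hw
    have h2 : coordSum ((1 - s) • z) = (1 - s) * coordSum z := by
      simp [coordSum, Finset.mul_sum]
    rw [h2] at h1
    nlinarith
  · rintro _ ⟨w, hw, rfl⟩
    exact hmin' w ((mem_recordFrontier_iff hx).1 hw).1

lemma isGreatest_frontierMax {x : ℕ → Fin d → ℝ} (hd : 1 ≤ d)
    (hx : ∀ i j, 0 < x i j) {n : ℕ} (hn : 1 ≤ n) :
    IsGreatest (coordSum '' recordFrontier x n) (frontierMax x n) := by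
  obtain ⟨i, -, h, -⟩ := exists_isGreatest_recordFrontier hd hx hn
  rwa [frontierMax, h.csSup_eq]

lemma isLeast_frontierMin {x : ℕ → Fin d → ℝ} (hd : 1 ≤ d)
    (hx : ∀ i j, 0 < x i j) {n : ℕ} (hn : 1 ≤ n) :
    IsLeast (coordSum '' recordFrontier x n) (frontierMin x n) := by
  obtain ⟨z, -, h, -⟩ := exists_isLeast_recordFrontier hd hx hn
  rwa [frontierMin, h.csInf_eq]

lemma frontierMax_eq_sup' {x : ℕ → Fin d → ℝ} (hd : 1 ≤ d)
    (hx : ∀ i j, 0 < x i j) {n : ℕ} (hn : 1 ≤ n) :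
    frontierMax x n = (Finset.range n).sup' ⟨0, Finset.mem_range.2 hn⟩ fun i => coordSum (x i) := by
  obtain ⟨i, hi, h, hmax⟩ := exists_isGreatest_recordFrontier hd hx hn
  rw [frontierMax, h.csSup_eq]
  refine le_antisymm (Finset.le_sup' (fun i => coordSum (x i)) (Finset.mem_range.2 hi)) ?_
  exact Finset.sup'_le _ _ fun k hk => hmax k (Finset.mem_range.1 hk)

lemma frontierMin_le {x : ℕ → Fin d → ℝ} (hd : 1 ≤ d) (hx : ∀ i j, 0 < x i j) {n : ℕ}
    (hn : 1 ≤ n) {z : Fin d → ℝ} (hz : z ∈ recordRegion x n) : frontierMin x n ≤ coordSum z := by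
  obtain ⟨w, -, h, hmin⟩ := exists_isLeast_recordFrontier hd hx hn
  rw [frontierMin, h.csInf_eq]
  exact hmin z hz

lemma exists_coordSum_eq_frontierMin {x : ℕ → Fin d → ℝ} (hd : 1 ≤ d) (hx : ∀ i j, 0 < x i j)
    {n : ℕ} (hn : 1 ≤ n) : ∃ z ∈ recordRegion x n, coordSum z = frontierMin x n := by
  obtain ⟨w, hw, h, -⟩ := exists_isLeast_recordFrontier hd hx hn
  exact ⟨w, hw, by rw [frontierMin, h.csInf_eq]⟩

lemma frontierMin_mono {x : ℕ → Fin d → ℝ} (hd : 1 ≤ d) (hx : ∀ i j, 0 < x i j) {m n : ℕ}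
    (hm : 1 ≤ m) (hmn : m ≤ n) : frontierMin x m ≤ frontierMin x n := by
  obtain ⟨z, hz, h⟩ := exists_coordSum_eq_frontierMin hd hx (hm.trans hmn)
  rw [← h]
  exact frontierMin_le hd hx hm ⟨hz.1, fun i hi => hz.2 i (hi.trans_le hmn)⟩

lemma coordSum_le_frontierMax {x : ℕ → Fin d → ℝ} (hd : 1 ≤ d) (hx : ∀ i j, 0 < x i j) {i n : ℕ}
    (hi : i < n) : coordSum (x i) ≤ frontierMax x n := by
  rw [frontierMax_eq_sup' hd hx (by omega)]
  exact Finset.le_sup' (fun i => coordSum (x i)) (Finset.mem_range.2 hi)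

lemma exists_coordSum_eq_frontierMax {x : ℕ → Fin d → ℝ} (hd : 1 ≤ d) (hx : ∀ i j, 0 < x i j)
    {n : ℕ} (hn : 1 ≤ n) : ∃ i < n, coordSum (x i) = frontierMax x n := by
  obtain ⟨i, hi, h, -⟩ := exists_isGreatest_recordFrontier hd hx hn
  exact ⟨i, hi, by rw [frontierMax, h.csSup_eq]⟩

lemma frontierMax_mono {x : ℕ → Fin d → ℝ} (hd : 1 ≤ d) (hx : ∀ i j, 0 < x i j) {m n : ℕ}
    (hm : 1 ≤ m) (hmn : m ≤ n) : frontierMax x m ≤ frontierMax x n := by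
  obtain ⟨i, hi, h⟩ := exists_coordSum_eq_frontierMax hd hx hm
  rw [← h]
  exact coordSum_le_frontierMax hd hx (hi.trans_le hmn)

/-- In dimension one the frontier is a single point, so its width vanishes. -/
lemma frontierWidth_dim_one {x : ℕ → Fin 1 → ℝ} (hx : ∀ i j, 0 < x i j) {n : ℕ} (hn : 1 ≤ n) :
    frontierWidth x n = 0 := by
  obtain ⟨i, hi, hmax⟩ := exists_coordSum_eq_frontierMax le_rfl hx hn
  obtain ⟨z, hz, hmin⟩ := exists_coordSum_eq_frontierMin le_rfl hx hn
  have h1 : coordSum (x i) ≤ coordSum z := by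
    have := hz.2 i hi
    simp only [StrictDom, Fin.forall_fin_one, not_lt] at this
    simpa [coordSum] using this
  have h2 := (isLeast_frontierMin le_rfl hx hn).2 (isGreatest_frontierMax le_rfl hx hn).1
  rw [frontierWidth]
  linarith

/-- The least coordinate sum can be tested on rational points. -/
lemma frontierMin_lt_iff {x : ℕ → Fin d → ℝ} (hd : 1 ≤ d) (hx : ∀ i j, 0 < x i j) {n : ℕ}
    (hn : 1 ≤ n) {a : ℝ} :
    frontierMin x n < a ↔ ∃ q : Fin d → ℚ, (fun j => (q j : ℝ)) ∈ recordRegion x n ∧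
      coordSum (fun j => (q j : ℝ)) < a := by
  constructor
  · intro h
    obtain ⟨z, hz, hza⟩ := exists_coordSum_eq_frontierMin hd hx hn
    have hd0 : (0 : ℝ) < d := by exact_mod_cast hd
    -- The slack is shared equally among the coordinates. Rounding upwards is safe because the
    -- region is closed under increasing coordinates.
    set ε := (a - coordSum z) / d with hε
    have hε0 : 0 < ε := div_pos (by linarith) hd0
    choose q hq1 hq2 using fun j => exists_rat_btwn (show z j < z j + ε by linarith)
    refine ⟨q, ⟨fun j => (hz.1 j).trans (hq1 j).le, fun i hi hdom =>
      hz.2 i hi fun j => (hq1 j).trans (hdom j)⟩, ?_⟩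
    have : Nonempty (Fin d) := ⟨⟨0, hd⟩⟩
    calc coordSum (fun j => (q j : ℝ)) < ∑ j, (z j + ε) :=
          Finset.sum_lt_sum_of_nonempty Finset.univ_nonempty fun j _ => hq2 j
      _ = coordSum z + d * ε := by simp [Finset.sum_add_distrib, coordSum]
      _ = a := by rw [hε]; field_simp; ring
  · rintro ⟨q, hq, hqa⟩
    exact (frontierMin_le hd hx hn hq).trans_lt hqa

end Geometry

/-! ### Tails of exponential vectors and of their coordinate sums. -/

section ExponentialVector

instance isProbabilityMeasure_expMeasure_one : IsProbabilityMeasure (expMeasure 1) :=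
  isProbabilityMeasure_expMeasure one_pos

/-- The law of a vector of `d` independent Exponential(1) coordinates. -/
noncomputable abbrev expVec (d : ℕ) : Measure (Fin d → ℝ) := Measure.pi fun _ : Fin d => expMeasure 1

lemma expMeasure_one_Ioi {z : ℝ} (hz : 0 ≤ z) :
    expMeasure 1 (Set.Ioi z) = ENNReal.ofReal (Real.exp (-z)) := by
  have h1 : (expMeasure 1).real (Set.Iic z) = 1 - Real.exp (-z) := by
    rw [← cdf_eq_real, cdf_expMeasure_eq one_pos, if_pos hz, one_mul]
  rw [← Set.compl_Iic, ← ofReal_measureReal, probReal_compl_eq_one_sub measurableSet_Iic, h1,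
    sub_sub_cancel]

lemma expMeasure_one_eq_withDensity : expMeasure 1 = volume.withDensity (exponentialPDF 1) := rfl

lemma measurable_exponentialPDF_one : Measurable (exponentialPDF 1) :=
  (measurable_exponentialPDFReal 1).ennreal_ofReal

lemma exponentialPDF_one_of_nonneg {y : ℝ} (hy : 0 ≤ y) :
    exponentialPDF 1 y = ENNReal.ofReal (Real.exp (-y)) := by
  rw [exponentialPDF_of_nonneg hy, one_mul, one_mul]

variable {d : ℕ}

lemma ae_expVec_pos : ∀ᵐ y ∂expVec d, ∀ j, 0 < y j := by
  rw [ae_all_iff]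
  intro j
  have h : ∀ᵐ t ∂expMeasure 1, 0 < t := by
    change expMeasure 1 (Set.Ioi 0)ᶜ = 0
    rw [prob_compl_eq_zero_iff measurableSet_Ioi, expMeasure_one_Ioi le_rfl]
    simp
  exact (Measure.quasiMeasurePreserving_eval (μ := fun _ : Fin d => expMeasure 1) j).ae h

lemma measurableSet_strictDom (z : Fin d → ℝ) : MeasurableSet {y | StrictDom z y} := by
  simp only [StrictDom, Set.ofPred_forall]
  exact MeasurableSet.iInter fun j => measurableSet_lt measurable_const (measurable_pi_apply j)

/-- The exponential tails multiply, so only the coordinate sum of `z` matters. -/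
lemma expVec_strictDom {z : Fin d → ℝ} (hz : z ∈ orthant d) :
    (expVec d).real {y | StrictDom z y} = Real.exp (-coordSum z) := by
  have h : {y | StrictDom z y} = Set.univ.pi fun j => Set.Ioi (z j) := by
    ext y; simp [StrictDom]
  rw [h, measureReal_def, Measure.pi_pi, ENNReal.toReal_prod, coordSum, ← Finset.sum_neg_distrib,
    Real.exp_sum]
  refine Finset.prod_congr rfl fun j _ => ?_
  rw [expMeasure_one_Ioi (hz j), ENNReal.toReal_ofReal (Real.exp_nonneg _)]

lemma measurableSet_lt_coordSum (x : ℝ) : MeasurableSet {y : Fin d → ℝ | x < coordSum y} :=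
  measurableSet_lt measurable_const continuous_coordSum.measurable

/-- Conditioning on the first coordinate; this recursion drives both Gamma tail bounds. -/
lemma expVec_lt_coordSum_succ (d : ℕ) (x : ℝ) :
    expVec (d + 1) {y | x < coordSum y} =
      ∫⁻ t, exponentialPDF 1 t * expVec d {y | x - t < coordSum y} := by
  have hmp := measurePreserving_piFinSuccAbove (fun _ : Fin (d + 1) => expMeasure 1) 0
  have hset : {y : Fin (d + 1) → ℝ | x < coordSum y} =
      MeasurableEquiv.piFinSuccAbove (fun _ => ℝ) 0 ⁻¹'
        {p : ℝ × (Fin d → ℝ) | x < p.1 + coordSum p.2} := by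
    ext y
    simp [coordSum, Fin.sum_univ_succ, MeasurableEquiv.piFinSuccAbove, Fin.insertNthEquiv,
      Fin.tail]
  have hm : MeasurableSet {p : ℝ × (Fin d → ℝ) | x < p.1 + coordSum p.2} :=
    measurableSet_lt measurable_const
      (measurable_fst.add (continuous_coordSum.measurable.comp measurable_snd))
  have hsec : ∀ t, Prod.mk t ⁻¹' {p : ℝ × (Fin d → ℝ) | x < p.1 + coordSum p.2} =
      {y | x - t < coordSum y} := by
    intro t; ext y; simp [sub_lt_iff_lt_add']
  have hG : Measurable fun t => expVec d {y | x - t < coordSum y} := by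
    simpa only [hsec] using measurable_measure_prodMk_left (ν := expVec d) hm
  rw [hset, hmp.measure_preimage hm.nullMeasurableSet, Measure.prod_apply hm]
  simp_rw [hsec]
  exact lintegral_withDensity_eq_lintegral_mul _ measurable_exponentialPDF_one hG

lemma expVec_one_lt_coordSum {x : ℝ} (hx : 0 ≤ x) :
    expVec 1 {y | x < coordSum y} = ENNReal.ofReal (Real.exp (-x)) := by
  have h : {y : Fin 1 → ℝ | x < coordSum y} = Set.univ.pi fun _ => Set.Ioi x := by
    ext y; simp [coordSum]
  rw [h, Measure.pi_pi]
  simp [expMeasure_one_Ioi hx]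

/-- By induction: a first coordinate above `x` costs `exp (-x)`, and on `[0, x]` the exponentials
combine to `exp (-x)`, so integration adds one power of `x`. -/
lemma expVec_lt_coordSum_le (d : ℕ) {x : ℝ} (hx : 0 ≤ x) :
    expVec (d + 1) {y | x < coordSum y} ≤ ENNReal.ofReal ((1 + x) ^ d * Real.exp (-x)) := by
  induction d generalizing x with
  | zero => simp [expVec_one_lt_coordSum hx]
  | succ d ih =>
    rw [expVec_lt_coordSum_succ, ← lintegral_add_compl _ (measurableSet_Ioi (a := x)),
      Set.compl_Ioi, ← Set.Iio_union_Icc_eq_Iic hx]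
    have h1 : ∫⁻ t in Set.Ioi x, exponentialPDF 1 t * expVec (d + 1) {y | x - t < coordSum y} ≤
        ENNReal.ofReal (Real.exp (-x)) := by
      rw [← expMeasure_one_Ioi hx, expMeasure_one_eq_withDensity,
        withDensity_apply _ measurableSet_Ioi]
      exact lintegral_mono fun t => mul_le_of_le_one_right' prob_le_one
    have h2 : ∫⁻ t in Set.Iio 0, exponentialPDF 1 t * expVec (d + 1) {y | x - t < coordSum y} = 0 := by
      refine setLIntegral_eq_zero measurableSet_Iio fun t ht => ?_
      simp [exponentialPDF_of_neg ht]
    have h3 : ∫⁻ t in Set.Icc 0 x, exponentialPDF 1 t * expVec (d + 1) {y | x - t < coordSum y} ≤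
        ENNReal.ofReal (x * ((1 + x) ^ d * Real.exp (-x))) := by
      calc _ ≤ ∫⁻ _ in Set.Icc 0 x, ENNReal.ofReal ((1 + x) ^ d * Real.exp (-x)) := by
            refine setLIntegral_mono' measurableSet_Icc fun t ht => ?_
            rw [exponentialPDF_one_of_nonneg ht.1]
            refine (mul_le_mul_right (ih (sub_nonneg.2 ht.2)) _).trans ?_
            rw [← ENNReal.ofReal_mul (Real.exp_nonneg _)]
            refine ENNReal.ofReal_le_ofReal ?_
            have h4 : Real.exp (-t) * Real.exp (-(x - t)) = Real.exp (-x) := by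
              rw [← Real.exp_add]; ring_nf
            calc _ = (1 + (x - t)) ^ d * (Real.exp (-t) * Real.exp (-(x - t))) := by ring
              _ = (1 + (x - t)) ^ d * Real.exp (-x) := by rw [h4]
              _ ≤ _ := by
                have : 0 ≤ 1 + (x - t) := by linarith [ht.2]
                gcongr
                linarith [ht.1]
        _ = _ := by
            rw [setLIntegral_const, Real.volume_Icc, sub_zero, mul_comm, ENNReal.ofReal_mul hx]
    calc _ ≤ ENNReal.ofReal (Real.exp (-x)) +
          (0 + ENNReal.ofReal (x * ((1 + x) ^ d * Real.exp (-x)))) := by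
          refine add_le_add h1 ((lintegral_union_le _ _ _).trans (add_le_add h2.le h3))
      _ = ENNReal.ofReal ((1 + x * (1 + x) ^ d) * Real.exp (-x)) := by
          rw [zero_add, ← ENNReal.ofReal_add (Real.exp_nonneg _) (by positivity)]
          ring_nf
      _ ≤ _ := by
          refine ENNReal.ofReal_le_ofReal (mul_le_mul_of_nonneg_right ?_ (Real.exp_nonneg _))
          rw [pow_succ]
          nlinarith [one_le_pow₀ (n := d) (show 1 ≤ 1 + x by linarith)]

/-- Keeping only first coordinates in `[0, x / 2]` leaves at least `x / 2` for the others, which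
loses just a constant factor. -/
lemma exists_le_expVec_lt_coordSum (d : ℕ) : ∃ c : ℝ, 0 < c ∧ ∀ x : ℝ, 0 ≤ x →
    ENNReal.ofReal (c * x ^ d * Real.exp (-x)) ≤ expVec (d + 1) {y | x < coordSum y} := by
  induction d with
  | zero => exact ⟨1, one_pos, fun x hx => by simp [expVec_one_lt_coordSum hx]⟩
  | succ d ih =>
    obtain ⟨c, hc, ih⟩ := ih
    refine ⟨c / 2 ^ (d + 1), by positivity, fun x hx => ?_⟩
    rw [expVec_lt_coordSum_succ]
    calc _ = ∫⁻ _ in Set.Icc 0 (x / 2), ENNReal.ofReal (c * (x / 2) ^ d * Real.exp (-x)) := by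
          rw [setLIntegral_const, Real.volume_Icc, sub_zero,
            ← ENNReal.ofReal_mul (by positivity)]
          congr 1
          rw [div_pow]
          field_simp
          ring
      _ ≤ ∫⁻ t in Set.Icc 0 (x / 2),
            exponentialPDF 1 t * expVec (d + 1) {y | x - t < coordSum y} := by
          refine setLIntegral_mono' measurableSet_Icc fun t ht => ?_
          have h2 := ht.2
          rw [exponentialPDF_one_of_nonneg ht.1]
          refine le_trans ?_ (mul_le_mul_right (ih (x - t) (by linarith)) _)
          rw [← ENNReal.ofReal_mul (Real.exp_nonneg _)]
          refine ENNReal.ofReal_le_ofReal ?_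
          have h4 : Real.exp (-t) * Real.exp (-(x - t)) = Real.exp (-x) := by
            rw [← Real.exp_add]; ring_nf
          calc c * (x / 2) ^ d * Real.exp (-x) ≤ c * (x - t) ^ d * Real.exp (-x) := by
                gcongr
                linarith
            _ = c * (x - t) ^ d * (Real.exp (-t) * Real.exp (-(x - t))) := by rw [h4]
            _ = _ := by ring
      _ ≤ _ := setLIntegral_le_lintegral _ _

end ExponentialVector

/-! ### Hitting probabilities and Borel–Cantelli for i.i.d. sequences. -/

section IdenticallyDistributed

variable {Ω E : Type*} [MeasurableSpace Ω] [MeasurableSpace E] {P : Measure Ω}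
  {X : ℕ → Ω → E} {μ : Measure E}

lemma measureReal_preimage_of_map_eq (hm : ∀ i, Measurable (X i)) (hmap : ∀ i, P.map (X i) = μ)
    {A : Set E} (hA : MeasurableSet A) (i : ℕ) : P.real (X i ⁻¹' A) = μ.real A := by
  rw [← hmap i, map_measureReal_apply (hm i) hA]

lemma measureReal_forall_notMem_le [IsProbabilityMeasure μ] (hindep : iIndepFun X P)
    (hm : ∀ i, Measurable (X i)) (hmap : ∀ i, P.map (X i) = μ) {A : Set E} (hA : MeasurableSet A)
    (n : ℕ) : P.real {ω | ∀ i < n, X i ω ∉ A} ≤ Real.exp (-(n * μ.real A)) := by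
  have h := hindep.measure_inter_preimage_eq_mul (Finset.range n) (sets := fun _ => Aᶜ)
    fun _ _ => hA.compl
  have hset : {ω | ∀ i < n, X i ω ∉ A} = ⋂ i ∈ Finset.range n, X i ⁻¹' Aᶜ := by
    ext ω; simp
  rw [hset, measureReal_def, h, ENNReal.toReal_prod]
  have h1 : ∀ i, (P (X i ⁻¹' Aᶜ)).toReal = 1 - μ.real A := by
    intro i
    rw [← measureReal_def, measureReal_preimage_of_map_eq hm hmap hA.compl,
      probReal_compl_eq_one_sub hA]
  simp only [h1, Finset.prod_const, Finset.card_range]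
  calc (1 - μ.real A) ^ n ≤ Real.exp (-μ.real A) ^ n := by
        refine pow_le_pow_left₀ (by linarith [measureReal_le_one (μ := μ) (s := A)]) ?_ n
        linarith [Real.add_one_le_exp (-μ.real A)]
    _ = _ := by rw [← Real.exp_nat_mul, mul_neg]

lemma measureReal_exists_mem_le (hm : ∀ i, Measurable (X i)) (hmap : ∀ i, P.map (X i) = μ)
    {A : Set E} (hA : MeasurableSet A) (n : ℕ) :
    P.real {ω | ∃ i < n, X i ω ∈ A} ≤ n * μ.real A := by
  have hset : {ω | ∃ i < n, X i ω ∈ A} = ⋃ i ∈ Finset.range n, X i ⁻¹' A := by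
    ext ω; simp
  rw [hset]
  refine (measureReal_biUnion_finset_le _ _).trans ?_
  simp [measureReal_preimage_of_map_eq hm hmap hA]

lemma measureReal_forall_mem_of_injective (hindep : iIndepFun X P)
    (hm : ∀ i, Measurable (X i)) (hmap : ∀ i, P.map (X i) = μ) {m : ℕ} {A : Fin m → Set E}
    (hA : ∀ k, MeasurableSet (A k)) {f : Fin m → ℕ} (hf : f.Injective) :
    P.real {ω | ∀ k, X (f k) ω ∈ A k} = ∏ k, μ.real (A k) := by
  have h := (hindep.precomp hf).measure_inter_preimage_eq_mul Finset.univ (sets := A)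
    fun k _ => hA k
  have hset : {ω | ∀ k, X (f k) ω ∈ A k} = ⋂ k ∈ Finset.univ, X (f k) ⁻¹' A k := by
    ext ω; simp
  rw [hset, measureReal_def, h, ENNReal.toReal_prod]
  exact Finset.prod_congr rfl fun k _ => measureReal_preimage_of_map_eq hm hmap (hA k) _

variable [IsProbabilityMeasure P]

/-- The **first Borel–Cantelli lemma** with real-valued bounds. -/
lemma ae_eventually_notMem_of_summable {B : ℕ → Set Ω} {b : ℕ → ℝ}
    (hB : ∀ᶠ k in atTop, P.real (B k) ≤ b k) (hb : Summable b) :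
    ∀ᵐ ω ∂P, ∀ᶠ k in atTop, ω ∉ B k := by
  refine ae_eventually_notMem ?_
  have hs : Summable fun k => P.real (B k) :=
    Summable.of_norm_bounded_eventually_nat hb (by
      filter_upwards [hB] with k hk
      rwa [Real.norm_of_nonneg measureReal_nonneg])
  have := hs.tsum_ofReal_ne_top
  simpa [ofReal_measureReal] using this

/-- The probability that each of `m` sets is hit by the first `n` observations: either distinct
observations do it, or some observation lies in two of the sets. -/
lemma measureReal_forall_exists_mem_le (hindep : iIndepFun X P)
    (hm : ∀ i, Measurable (X i)) (hmap : ∀ i, P.map (X i) = μ) {m : ℕ} {A : Fin m → Set E}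
    (hA : ∀ k, MeasurableSet (A k)) {p q : ℝ} (hp : ∀ k, μ.real (A k) ≤ p)
    (hq : ∀ k l, k ≠ l → μ.real (A k ∩ A l) ≤ q) (hq0 : 0 ≤ q) (n : ℕ) :
    P.real {ω | ∀ k, ∃ i < n, X i ω ∈ A k} ≤ (n * p) ^ m + m ^ 2 * (n * q) := by
  classical
  set S : Set Ω := ⋃ f ∈ (Finset.univ.filter fun f : Fin m → Fin n => f.Injective),
    {ω | ∀ k, X (f k) ω ∈ A k}
  set T : Set Ω := ⋃ r ∈ (Finset.univ.filter fun r : Fin m × Fin m => r.1 ≠ r.2),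
    {ω | ∃ i < n, X i ω ∈ A r.1 ∩ A r.2}
  have hsub : {ω | ∀ k, ∃ i < n, X i ω ∈ A k} ⊆ S ∪ T := by
    intro ω hω
    choose f hfn hf using hω
    by_cases hinj : f.Injective
    · left
      simp only [S, Set.mem_iUnion]
      refine ⟨fun k => ⟨f k, hfn k⟩, by
        simp only [Finset.mem_filter, Finset.mem_univ, true_and]
        exact fun k l h => hinj (congrArg Fin.val h), ?_⟩
      exact hf
    · right
      simp only [Function.Injective, not_forall] at hinj
      obtain ⟨k, l, hkl, hne⟩ := hinj
      simp only [T, Set.mem_iUnion]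
      exact ⟨(k, l), by simpa using hne, f k, hfn k, hf k, hkl ▸ hf l⟩
  have hS : P.real S ≤ (n * p) ^ m := by
    refine (measureReal_biUnion_finset_le _ _).trans ?_
    calc _ ≤ ∑ f ∈ (Finset.univ.filter fun f : Fin m → Fin n => f.Injective), p ^ m := by
          refine Finset.sum_le_sum fun f hf => ?_
          simp only [Finset.mem_filter, Finset.mem_univ, true_and] at hf
          rw [measureReal_forall_mem_of_injective hindep hm hmap hA (f := fun k => f k)
            (Fin.val_injective.comp hf)]
          refine (Finset.prod_le_prod (fun _ _ => measureReal_nonneg) fun k _ => hp k).trans ?_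
          simp
      _ ≤ (n : ℝ) ^ m * p ^ m := by
          -- When `m = 0`, nothing forces `0 ≤ p`.
          rcases Nat.eq_zero_or_pos m with rfl | hm0
          · rw [Finset.sum_const, nsmul_eq_mul, pow_zero, pow_zero, mul_one]
            exact_mod_cast (Finset.card_le_univ _).trans (by simp)
          · have hp0 : 0 ≤ p := measureReal_nonneg.trans (hp ⟨0, hm0⟩)
            rw [Finset.sum_const, nsmul_eq_mul]
            refine mul_le_mul_of_nonneg_right ?_ (by positivity)
            calc _ ≤ ((Finset.univ : Finset (Fin m → Fin n)).card : ℝ) := by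
                  exact_mod_cast Finset.card_le_univ _
              _ = _ := by simp
      _ = _ := (mul_pow _ _ _).symm
  have hT : P.real T ≤ m ^ 2 * (n * q) := by
    refine (measureReal_biUnion_finset_le _ _).trans ?_
    calc _ ≤ ∑ r ∈ (Finset.univ.filter fun r : Fin m × Fin m => r.1 ≠ r.2), n * q := by
          refine Finset.sum_le_sum fun r hr => ?_
          simp only [Finset.mem_filter, Finset.mem_univ, true_and] at hr
          refine (measureReal_exists_mem_le hm hmap ((hA _).inter (hA _)) n).trans ?_
          exact mul_le_mul_of_nonneg_left (hq _ _ hr) (Nat.cast_nonneg n)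
      _ ≤ _ := by
          rw [Finset.sum_const, nsmul_eq_mul]
          refine mul_le_mul_of_nonneg_right ?_ (by positivity)
          calc _ ≤ ((Finset.univ : Finset (Fin m × Fin m)).card : ℝ) := by
                exact_mod_cast Finset.card_le_univ _
            _ = _ := by simp [sq]
  calc _ ≤ P.real (S ∪ T) := measureReal_mono hsub
    _ ≤ _ := (measureReal_union_le _ _).trans (add_le_add hS hT)

/-- The **second Borel–Cantelli lemma** for observations falling in a sequence of sets. -/
lemma ae_frequently_mem_of_not_summable [IsProbabilityMeasure μ] (hindep : iIndepFun X P)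
    (hm : ∀ i, Measurable (X i)) (hmap : ∀ i, P.map (X i) = μ) {A : ℕ → Set E}
    (hA : ∀ n, MeasurableSet (A n)) (hs : ¬ Summable fun n => μ.real (A n)) :
    ∀ᵐ ω ∂P, ∃ᶠ n in atTop, X n ω ∈ A n := by
  have hmeas : ∀ n, MeasurableSet (X n ⁻¹' A n) := fun n => hm n (hA n)
  have hi : iIndepSet (fun n => X n ⁻¹' A n) P := by
    rw [iIndepSet_iff_meas_biInter hmeas]
    intro s
    exact hindep.measure_inter_preimage_eq_mul s fun n _ => hA n
  have htop : ∑' n, P (X n ⁻¹' A n) = ⊤ := by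
    by_contra hne
    apply hs
    have := ENNReal.summable_toReal hne
    refine this.congr fun n => ?_
    rw [← measureReal_def, measureReal_preimage_of_map_eq hm hmap (hA n)]
  have h1 := measure_limsup_eq_one hmeas hi htop
  have h2 := (prob_compl_eq_zero_iff (μ := P) (.measurableSet_limsup hmeas)).2 h1
  have h3 : ∀ᵐ ω ∂P, ω ∈ limsup (fun n => X n ⁻¹' A n) atTop := h2
  filter_upwards [h3] with ω hω
  exact mem_limsup_iff_frequently_mem.1 hω

end IdenticallyDistributed

/-! ### Dyadic interpolation, series, and rescaled tails. -/

section Asymptotic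

lemma tendsto_log_log_nat : Tendsto (fun n : ℕ => Real.log (Real.log n)) atTop atTop :=
  Real.tendsto_log_atTop.comp (Real.tendsto_log_atTop.comp tendsto_natCast_atTop_atTop)

lemma tendsto_log_nat : Tendsto (fun n : ℕ => Real.log n) atTop atTop :=
  Real.tendsto_log_atTop.comp tendsto_natCast_atTop_atTop

/-- For `K ≥ 4` the ratio `u / K` lies between `(3 / 4) * log 2 > 1 / e` and `(5 / 4) * log 2 < e`.
Applied to `u = log n` and a power `2 ^ K` next to `n`. -/
lemma abs_log_log_sub_log_le {u K : ℝ} (hK : 4 ≤ K) (h1 : (K - 1) * Real.log 2 ≤ u)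
    (h2 : u ≤ (K + 1) * Real.log 2) : |Real.log u - Real.log K| ≤ 1 := by
  have l1 := Real.log_two_gt_d9
  have l2 := Real.log_two_lt_d9
  have e1 := Real.exp_one_gt_d9
  have hu : 0 < u := lt_of_lt_of_le (by nlinarith) h1
  have hK0 : 0 < K := by linarith
  rw [← Real.log_div hu.ne' hK0.ne', abs_le]
  constructor
  · rw [Real.le_log_iff_exp_le (by positivity), Real.exp_neg, inv_le_comm₀ (Real.exp_pos _)
      (by positivity), inv_div, div_le_iff₀ hu]
    nlinarith
  · rw [Real.log_le_iff_le_exp (by positivity), div_le_iff₀ hK0]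
    nlinarith

lemma tendsto_nat_log_two : Tendsto (fun n : ℕ => Nat.log 2 n) atTop atTop :=
  tendsto_atTop.2 fun k => by
    filter_upwards [eventually_ge_atTop (2 ^ k)] with n hn
    exact Nat.le_log_of_pow_le one_lt_two hn

lemma nat_log_mul_log_two_le {n : ℕ} (hn : 1 ≤ n) : (Nat.log 2 n : ℝ) * Real.log 2 ≤ Real.log n := by
  rw [← Real.log_pow]
  refine Real.log_le_log (by positivity) ?_
  exact_mod_cast Nat.pow_log_le_self 2 (by omega)

lemma log_le_nat_log_succ_mul_log_two {n : ℕ} (hn : 1 ≤ n) :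
    Real.log n ≤ (Nat.log 2 n + 1 : ℝ) * Real.log 2 := by
  have h : Real.log n ≤ Real.log ((2 : ℝ) ^ (Nat.log 2 n + 1)) := by
    refine Real.log_le_log (by exact_mod_cast hn) ?_
    exact_mod_cast (Nat.lt_pow_succ_log_self one_lt_two n).le
  rw [Real.log_pow] at h
  exact_mod_cast h

/-- A lower bound along powers of two extends to all indices for monotone sequences. -/
lemma eventually_le_of_dyadic {f : ℕ → ℝ} (hf : ∀ m n, 1 ≤ m → m ≤ n → f m ≤ f n) {c c' : ℝ}
    (hc : c' < c) (h : ∀ᶠ k : ℕ in atTop, k * Real.log 2 + c * Real.log k ≤ f (2 ^ k)) :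
    ∀ᶠ n : ℕ in atTop, c' ≤ (f n - Real.log n) / Real.log (Real.log n) := by
  -- Replacing `n` by a neighbouring power of two costs at most `log 2 < 1` in the main term and
  -- `|c|` in the correction; the last threshold makes the gap `c - c'` absorb both.
  filter_upwards [tendsto_nat_log_two.eventually h, tendsto_nat_log_two.eventually_ge_atTop 4,
    eventually_ge_atTop 1, tendsto_log_log_nat.eventually_gt_atTop 0,
    tendsto_log_log_nat.eventually_ge_atTop ((1 + |c|) / (c - c'))] with n h1 h4 hn hpos hbig
  have l2 := Real.log_two_lt_d9
  have l1 := Real.log_two_gt_d9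
  rw [le_div_iff₀ hpos]
  rw [div_le_iff₀ (by linarith)] at hbig
  have h5 : f (2 ^ Nat.log 2 n) ≤ f n := hf _ _ Nat.one_le_two_pow (Nat.pow_log_le_self 2 (by omega))
  have h6 := nat_log_mul_log_two_le hn
  have h7 := log_le_nat_log_succ_mul_log_two hn
  have h8 := abs_log_log_sub_log_le (u := Real.log n) (K := Nat.log 2 n) (by exact_mod_cast h4)
    (by nlinarith) h7
  have h9 : |c * (Real.log (Real.log n) - Real.log (Nat.log 2 n))| ≤ |c| := by
    rw [abs_mul]; exact mul_le_of_le_one_right (abs_nonneg c) h8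
  have h10 := (abs_le.1 h9).2
  nlinarith

/-- An upper bound along powers of two extends to all indices for monotone sequences. -/
lemma eventually_ge_of_dyadic {f : ℕ → ℝ} (hf : ∀ m n, 1 ≤ m → m ≤ n → f m ≤ f n) {c c' : ℝ}
    (hc : c < c') (h : ∀ᶠ k : ℕ in atTop, f (2 ^ k) ≤ k * Real.log 2 + c * Real.log k) :
    ∀ᶠ n : ℕ in atTop, (f n - Real.log n) / Real.log (Real.log n) ≤ c' := by
  have ht : Tendsto (fun n : ℕ => Nat.log 2 n + 1) atTop atTop :=
    (tendsto_add_atTop_nat 1).comp tendsto_nat_log_two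
  filter_upwards [ht.eventually h, ht.eventually_ge_atTop 4,
    eventually_ge_atTop 1, tendsto_log_log_nat.eventually_gt_atTop 0,
    tendsto_log_log_nat.eventually_ge_atTop ((1 + |c|) / (c' - c))] with n h1 h4 hn hpos hbig
  have l2 := Real.log_two_lt_d9
  have l1 := Real.log_two_gt_d9
  rw [div_le_iff₀ hpos]
  rw [div_le_iff₀ (by linarith)] at hbig
  have h5 : f n ≤ f (2 ^ (Nat.log 2 n + 1)) := hf _ _ hn (Nat.lt_pow_succ_log_self one_lt_two n).le
  have h6 := nat_log_mul_log_two_le hn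
  have h7 := log_le_nat_log_succ_mul_log_two hn
  push_cast at h1
  have h8 := abs_log_log_sub_log_le (u := Real.log n) (K := Nat.log 2 n + 1)
    (by exact_mod_cast h4) (by simpa using h6) (by nlinarith)
  have h9 : |c * (Real.log (Real.log n) - Real.log (Nat.log 2 n + 1))| ≤ |c| := by
    rw [abs_mul]; exact mul_le_of_le_one_right (abs_nonneg c) h8
  have h10 := (abs_le.1 h9).1
  nlinarith

lemma summable_mul_exp_neg_rpow (D : ℕ) {a c : ℝ} (ha : 0 < a) (hc : 0 < c) :
    Summable fun k : ℕ => ((k : ℝ) + 1) ^ D * Real.exp (-(a * (k : ℝ) ^ c)) := by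
  -- At `x = k ^ c` this power is `k ^ (-(D + 2))`, leaving `k ^ (-2)` after the factor of degree
  -- `D`.
  have h1 : (fun x : ℝ => Real.exp (-a * x)) =O[atTop] fun x => x ^ (-(D + 2 : ℝ) / c) :=
    (isLittleO_exp_neg_mul_rpow_atTop ha _).isBigO
  have h2 : Tendsto (fun k : ℕ => (k : ℝ) ^ c) atTop atTop :=
    (tendsto_rpow_atTop hc).comp tendsto_natCast_atTop_atTop
  have h3 := h1.comp_tendsto h2
  have h4 : (fun k : ℕ => ((k : ℝ) + 1) ^ D) =O[atTop] fun k : ℕ => (k : ℝ) ^ D := by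
    refine IsBigO.pow ?_ D
    refine IsBigO.of_bound 2 ?_
    filter_upwards [eventually_ge_atTop 1] with k hk
    have : (1 : ℝ) ≤ k := by exact_mod_cast hk
    rw [Real.norm_of_nonneg (by positivity), Real.norm_of_nonneg (by positivity)]
    linarith
  have h5 : Summable fun k : ℕ => (k : ℝ) ^ (-2 : ℝ) := Real.summable_nat_rpow.2 (by norm_num)
  refine summable_of_isBigO_nat h5 ?_
  refine ((h4.mul h3).congr' (Eventually.of_forall fun k => ?_) ?_)
  · simp [neg_mul]
  · filter_upwards [eventually_ge_atTop 1] with k hk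
    have hk0 : (0 : ℝ) < k := by exact_mod_cast hk
    simp only [Function.comp]
    rw [← Real.rpow_mul hk0.le, ← Real.rpow_natCast, ← Real.rpow_add hk0]
    congr 1
    field_simp
    ring

lemma not_summable_inv_nat_mul_log : ¬ Summable fun n : ℕ => ((n : ℝ) * Real.log n)⁻¹ := by
  intro h
  rw [← summable_condensed_iff_of_eventually_nonneg] at h
  · have h1 : Summable fun k : ℕ => (Real.log 2)⁻¹ * (k : ℝ)⁻¹ := by
      refine h.congr fun k => ?_
      rw [Nat.cast_pow, Nat.cast_ofNat, Real.log_pow]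
      have : (2 : ℝ) ^ k ≠ 0 := by positivity
      field_simp
    rw [summable_mul_left_iff (by have := Real.log_pos one_lt_two; positivity)] at h1
    exact Real.not_summable_natCast_inv h1
  · refine Eventually.of_forall fun n => ?_
    have := Real.log_natCast_nonneg n
    simp only [Pi.zero_apply]
    positivity
  · filter_upwards [eventually_ge_atTop 2] with n hn
    have hn' : (2 : ℝ) ≤ n := by exact_mod_cast hn
    have hl : 0 < Real.log n := Real.log_pos (by linarith)
    push_cast
    gcongr <;> linarith

/-- If `log N ≤ y`, then `N` observations exceed `log N + c log y` with probability of order at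
most `y ^ (d - c)`. -/
lemma mul_tail_le (d : ℕ) {N y c : ℝ} (hN : 1 ≤ N) (hy : 1 ≤ y) (hc : 0 ≤ c)
    (hNy : Real.log N ≤ y) :
    N * (expVec (d + 1)).real {z | Real.log N + c * Real.log y < coordSum z} ≤
      (2 + c) ^ d * y ^ ((d : ℝ) - c) := by
  have hy0 : 0 < y := by linarith
  have hN0 : 0 < N := by linarith
  have hl : 0 ≤ Real.log y := Real.log_nonneg hy
  have ht : 0 ≤ Real.log N + c * Real.log y :=
    add_nonneg (Real.log_nonneg hN) (mul_nonneg hc hl)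
  have h1 : (expVec (d + 1)).real {z | Real.log N + c * Real.log y < coordSum z} ≤
      (1 + (Real.log N + c * Real.log y)) ^ d * Real.exp (-(Real.log N + c * Real.log y)) := by
    rw [measureReal_def]
    exact ENNReal.toReal_le_of_le_ofReal (by positivity) (expVec_lt_coordSum_le d ht)
  have h2 : Real.exp (-(Real.log N + c * Real.log y)) = N⁻¹ * y ^ (-c) := by
    rw [neg_add, Real.exp_add, Real.exp_neg, Real.exp_log hN0, Real.rpow_def_of_pos hy0]
    ring_nf
  have h3 : Real.log y ≤ y := (Real.log_le_sub_one_of_pos hy0).trans (by linarith)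
  calc _ ≤ N * ((1 + (Real.log N + c * Real.log y)) ^ d * (N⁻¹ * y ^ (-c))) := by
        rw [← h2]; exact mul_le_mul_of_nonneg_left h1 hN0.le
    _ = (1 + (Real.log N + c * Real.log y)) ^ d * y ^ (-c) := by field_simp
    _ ≤ ((2 + c) * y) ^ d * y ^ (-c) := by
        gcongr
        nlinarith
    _ = _ := by
        rw [mul_pow, mul_assoc, ← Real.rpow_natCast y, ← Real.rpow_add hy0, sub_eq_add_neg]

/-- Matching lower bound for `mul_tail_le`. Keeping `y` apart from `log N` allows both `y = log N`
and `N = 2 ^ k`, `y = k`, the latter because `log 2 > 1 / 2`. -/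
lemma exists_le_mul_tail (d : ℕ) : ∃ C : ℝ, 0 < C ∧ ∀ N y c : ℝ, 1 ≤ N → 1 ≤ y → 0 ≤ c →
    y / 2 ≤ Real.log N → C * y ^ ((d : ℝ) - c) ≤
      N * (expVec (d + 1)).real {z | Real.log N + c * Real.log y < coordSum z} := by
  obtain ⟨C, hC, h⟩ := exists_le_expVec_lt_coordSum d
  refine ⟨C / 2 ^ d, by positivity, fun N y c hN hy hc hNy => ?_⟩
  have hy0 : 0 < y := by linarith
  have hN0 : 0 < N := by linarith
  have hl : 0 ≤ Real.log y := Real.log_nonneg hy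
  have hcl := mul_nonneg hc hl
  have ht : 0 ≤ Real.log N + c * Real.log y := add_nonneg (Real.log_nonneg hN) hcl
  have h1 := (ENNReal.ofReal_le_iff_le_toReal (measure_ne_top _ _)).1 (h _ ht)
  rw [← measureReal_def] at h1
  have h2 : Real.exp (-(Real.log N + c * Real.log y)) = N⁻¹ * y ^ (-c) := by
    rw [neg_add, Real.exp_add, Real.exp_neg, Real.exp_log hN0, Real.rpow_def_of_pos hy0]
    ring_nf
  rw [h2] at h1
  calc C / 2 ^ d * y ^ ((d : ℝ) - c) = C * (y / 2) ^ d * y ^ (-c) := by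
        rw [sub_eq_add_neg, Real.rpow_add hy0, Real.rpow_natCast, div_pow]; ring
    _ ≤ C * (Real.log N + c * Real.log y) ^ d * y ^ (-c) := by
        gcongr
        linarith
    _ = N * (C * (Real.log N + c * Real.log y) ^ d * (N⁻¹ * y ^ (-c))) := by field_simp
    _ ≤ _ := mul_le_mul_of_nonneg_left h1 hN0.le

end Asymptotic

/-! ### Almost sure bounds for the two extremes. -/

section Sample

/-- The expected number, among `2 ^ k` observations, dominating a point of the orthant at level `k *
log 2 + c * log k`. -/
lemma two_pow_mul_exp_neg {k : ℕ} (hk : 1 ≤ k) (c : ℝ) :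
    (2 : ℝ) ^ k * Real.exp (-(k * Real.log 2 + c * Real.log k)) = (k : ℝ) ^ (-c) := by
  have hk0 : (0 : ℝ) < k := by exact_mod_cast hk
  rw [← Real.log_pow, neg_add, Real.exp_add, Real.exp_neg, Real.exp_log (by positivity),
    Real.rpow_def_of_pos hk0]
  field_simp

/-- An i.i.d. sequence of measurable random vectors with positive coordinates, each distributed
as `d` independent Exponential(1) random variables. -/
structure IsExpSample {Ω : Type*} [MeasurableSpace Ω] (P : Measure Ω) {d : ℕ}
    (X : ℕ → Ω → Fin d → ℝ) : Prop where
  indep : iIndepFun X P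
  meas : ∀ i, Measurable (X i)
  map_eq : ∀ i, P.map (X i) = expVec d
  pos : ∀ ω i j, 0 < X i ω j

variable {Ω : Type*} [MeasurableSpace Ω] {P : Measure Ω}

lemma IsExpSample.measurable_frontierMax {d : ℕ} {X : ℕ → Ω → Fin d → ℝ} (h : IsExpSample P X)
    (hd : 1 ≤ d) {n : ℕ} (hn : 1 ≤ n) : Measurable fun ω => frontierMax (fun i => X i ω) n := by
  simp_rw [fun ω => frontierMax_eq_sup' hd (h.pos ω) hn]
  obtain ⟨n, rfl⟩ := Nat.exists_eq_add_of_le' hn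
  exact Finset.measurable_range_sup'' fun i _ => continuous_coordSum.measurable.comp (h.meas i)

lemma IsExpSample.measurable_frontierMin {d : ℕ} {X : ℕ → Ω → Fin d → ℝ} (h : IsExpSample P X)
    (hd : 1 ≤ d) {n : ℕ} (hn : 1 ≤ n) : Measurable fun ω => frontierMin (fun i => X i ω) n := by
  refine measurable_of_Iio fun a => ?_
  have hset : (fun ω => frontierMin (fun i => X i ω) n) ⁻¹' Set.Iio a =
      ⋃ q : Fin d → ℚ, {ω | (fun j => (q j : ℝ)) ∈ recordRegion (fun i => X i ω) n ∧
        coordSum (fun j => (q j : ℝ)) < a} := by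
    ext ω
    simp [frontierMin_lt_iff hd (h.pos ω) hn]
  rw [hset]
  refine MeasurableSet.iUnion fun q => ?_
  have : {ω | (fun j => (q j : ℝ)) ∈ recordRegion (fun i => X i ω) n ∧
        coordSum (fun j => (q j : ℝ)) < a} =
      {ω | (fun j => (q j : ℝ)) ∈ orthant d ∧ coordSum (fun j => (q j : ℝ)) < a} ∩
        ⋂ i, ⋂ (_ : i < n), X i ⁻¹' {y | StrictDom (fun j => (q j : ℝ)) y}ᶜ := by
    ext ω
    simp [recordRegion]
    tauto
  rw [this]
  exact (MeasurableSet.const _).inter (MeasurableSet.iInter fun i => MeasurableSet.iInter fun _ =>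
    h.meas i (measurableSet_strictDom _).compl)

variable [IsProbabilityMeasure P]

/-- If the minimum is below `t k`, rounding up a minimiser gives an undominated integer point of sum
at most `t k + d`. There are at most `(k + 1) ^ d` candidates, each undominated with probability at
most `exp (-exp (-d) * k ^ c)`. -/
lemma IsExpSample.ae_eventually_le_frontierMin {d : ℕ} {X : ℕ → Ω → Fin d → ℝ}
    (h : IsExpSample P X) (hd : 1 ≤ d) {c : ℝ} (hc : 0 < c) :
    ∀ᵐ ω ∂P, ∀ᶠ k : ℕ in atTop,
      k * Real.log 2 + (-c) * Real.log k ≤ frontierMin (fun i => X i ω) (2 ^ k) := by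
  classical
  let t : ℕ → ℝ := fun k => k * Real.log 2 + (-c) * Real.log k
  -- With `g j = ⌊z j⌋₊`, the point `G k g` lies strictly above `z`, so an observation dominating it
  -- also dominates `z`. Since `t k ≤ k`, these floors fit in `Fin (k + 1)`.
  let G : ∀ k : ℕ, (Fin d → Fin (k + 1)) → Fin d → ℝ := fun k g j => (g j : ℝ) + 1
  let I : ∀ k : ℕ, Finset (Fin d → Fin (k + 1)) := fun k =>
    Finset.univ.filter fun g => coordSum (G k g) ≤ t k + d
  let B : ℕ → Set Ω := fun k => ⋃ g ∈ I k, {ω | ∀ i < 2 ^ k, X i ω ∉ {y | StrictDom (G k g) y}}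
  have hB : ∀ᶠ k in atTop, P.real (B k) ≤
      ((k : ℝ) + 1) ^ d * Real.exp (-(Real.exp (-d) * (k : ℝ) ^ c)) := by
    filter_upwards [eventually_ge_atTop 1] with k hk
    refine (measureReal_biUnion_finset_le _ _).trans ?_
    calc _ ≤ ∑ g ∈ I k, Real.exp (-(Real.exp (-d) * (k : ℝ) ^ c)) := by
          refine Finset.sum_le_sum fun g hg => ?_
          refine (measureReal_forall_notMem_le h.indep h.meas h.map_eq
            (measurableSet_strictDom _) _).trans ?_
          rw [expVec_strictDom (fun j => by positivity)]
          have hg' : coordSum (G k g) ≤ t k + d := by simpa [I] using hg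
          refine Real.exp_le_exp.2 (neg_le_neg ?_)
          have h1 := two_pow_mul_exp_neg hk (-c)
          rw [neg_neg] at h1
          rw [← h1]
          push_cast
          calc _ = (2 : ℝ) ^ k * Real.exp (-(t k + d)) := by
                have h2 : Real.exp (-(t k + d)) = Real.exp (-d) * Real.exp (-(t k)) := by
                  rw [← Real.exp_add]; ring_nf
                rw [h2]
                exact mul_left_comm _ _ _
            _ ≤ _ := by gcongr
      _ ≤ _ := by
          rw [Finset.sum_const, nsmul_eq_mul]
          refine mul_le_mul_of_nonneg_right ?_ (Real.exp_nonneg _)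
          calc _ ≤ ((Finset.univ : Finset (Fin d → Fin (k + 1))).card : ℝ) := by
                exact_mod_cast Finset.card_le_univ _
            _ = _ := by simp
  filter_upwards [ae_eventually_notMem_of_summable hB
    (summable_mul_exp_neg_rpow d (Real.exp_pos _) hc)] with ω hω
  filter_upwards [hω, eventually_ge_atTop 1] with k hk hk1
  by_contra! hlt
  apply hk
  obtain ⟨z, hz, hzt⟩ := exists_coordSum_eq_frontierMin hd (h.pos ω) (n := 2 ^ k)
    Nat.one_le_two_pow
  rw [← hzt] at hlt
  have hk0 : (1 : ℝ) ≤ k := by exact_mod_cast hk1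
  have htk : t k ≤ k := by
    have := Real.log_nonneg hk0
    have := Real.log_two_lt_d9
    simp only [t]
    nlinarith
  have hfl : ∀ j, ⌊z j⌋₊ < k + 1 := fun j => by
    refine (Nat.floor_lt (hz.1 j)).2 ?_
    push_cast
    have := le_coordSum hz.1 j
    linarith
  simp only [B, Set.mem_iUnion]
  refine ⟨fun j => ⟨⌊z j⌋₊, hfl j⟩, ?_, fun i hi hdom => hz.2 i hi fun j => ?_⟩
  · simp only [I, Finset.mem_filter, Finset.mem_univ, true_and]
    calc _ ≤ ∑ j, (z j + 1) := Finset.sum_le_sum fun j _ => by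
            simpa [G] using Nat.floor_le (hz.1 j)
      _ = coordSum z + d := by simp [Finset.sum_add_distrib, coordSum]
      _ ≤ _ := by linarith
  · exact (Nat.lt_floor_add_one (z j)).trans (hdom j)

/-- Equally spaced points on the face of the simplex of size `t` spanned by the first two axes. -/
noncomputable def simplexPoint (d m : ℕ) (t : ℝ) (r : Fin m) : Fin (d + 2) → ℝ :=
  Fin.cons (t * (r / m)) (Fin.cons (t * (1 - r / m)) 0)

lemma coordSum_simplexPoint {d m : ℕ} (t : ℝ) (r : Fin m) :
    coordSum (simplexPoint d m t r) = t := by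
  simp [coordSum, simplexPoint, Fin.sum_univ_succ]
  ring

lemma simplexPoint_mem_orthant {d m : ℕ} {t : ℝ} (ht : 0 ≤ t) (r : Fin m) :
    simplexPoint d m t r ∈ orthant (d + 2) := by
  have hr : (r : ℝ) / m ≤ 1 := div_le_one_of_le₀ (by exact_mod_cast r.2.le) (Nat.cast_nonneg m)
  intro j
  refine Fin.cases ?_ (fun j => Fin.cases ?_ (fun j => ?_) j) j
  · simp only [simplexPoint, Fin.cons_zero]; positivity
  · simp only [simplexPoint, Fin.cons_succ, Fin.cons_zero]
    exact mul_nonneg ht (by linarith)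
  · simp [simplexPoint]

/-- Dominating two points means dominating their join. The spacing raises its sum by at least `t /
m`, making double hits exponentially rarer. -/
lemma le_coordSum_sup_simplexPoint {d m : ℕ} {t : ℝ} (ht : 0 ≤ t) {r s : Fin m} (hrs : r ≠ s) :
    t * (1 + 1 / m) ≤ coordSum (simplexPoint d m t r ⊔ simplexPoint d m t s) := by
  wlog hlt : r < s generalizing r s
  · rw [sup_comm]
    exact this hrs.symm (lt_of_le_of_ne (not_lt.1 hlt) hrs.symm)
  have hm : (0 : ℝ) < m := by exact_mod_cast r.pos
  have h1 : (r : ℝ) + 1 ≤ s := by exact_mod_cast hlt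
  have h2 : (r : ℝ) / m + 1 / m ≤ s / m := by rw [← add_div]; gcongr
  calc t * (1 + 1 / m) ≤ t * (s / m) + t * (1 - r / m) := by
        rw [← mul_add]
        exact mul_le_mul_of_nonneg_left (by linarith) ht
    _ ≤ _ := by
        simp only [coordSum, simplexPoint, Fin.sum_univ_succ, Pi.sup_apply, Fin.cons_zero,
          Fin.cons_succ, Pi.zero_apply, sup_idem, Finset.sum_const_zero, add_zero]
        exact add_le_add le_sup_right le_sup_left

/-- A minimum above `t k` forces all `m` simplex points to be dominated. Distinct observations do
this with probability at most `k ^ (-(c * m))`, and double hits are exponentially unlikely. A single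
point would give only `k ^ (-c)`, hence several points and at least two axes. -/
lemma IsExpSample.ae_eventually_frontierMin_le {d : ℕ} {X : ℕ → Ω → Fin (d + 2) → ℝ}
    (h : IsExpSample P X) {c : ℝ} (hc : 0 < c) :
    ∀ᵐ ω ∂P, ∀ᶠ k : ℕ in atTop,
      frontierMin (fun i => X i ω) (2 ^ k) ≤ k * Real.log 2 + c * Real.log k := by
  obtain ⟨m, hm⟩ := exists_nat_gt (2 / c)
  have hm0 : (0 : ℝ) < m := lt_trans (by positivity) hm
  have hcm : 2 < c * m := by rwa [div_lt_iff₀ hc, mul_comm] at hm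
  have hl2 := Real.log_pos one_lt_two
  let t : ℕ → ℝ := fun k => k * Real.log 2 + c * Real.log k
  let B : ℕ → Set Ω := fun k => {ω | ∀ r : Fin m, ∃ i < 2 ^ k,
    X i ω ∈ {y | StrictDom (simplexPoint d m (t k) r) y}}
  have hB : ∀ᶠ k : ℕ in atTop, P.real (B k) ≤ (k : ℝ) ^ (-(c * m)) +
      m ^ 2 * (((k : ℝ) + 1) ^ 0 * Real.exp (-(Real.log 2 / m * (k : ℝ) ^ (1 : ℝ)))) := by
    filter_upwards [eventually_ge_atTop 1] with k hk
    have hk0 : (1 : ℝ) ≤ k := by exact_mod_cast hk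
    have hlk := Real.log_nonneg hk0
    have ht : k * Real.log 2 ≤ t k := le_add_of_nonneg_right (by positivity)
    have ht0 : 0 ≤ t k := le_trans (by positivity) ht
    have h1 := two_pow_mul_exp_neg hk c
    have h2 : (k : ℝ) ^ (-c) ≤ 1 := Real.rpow_le_one_of_one_le_of_nonpos hk0 (by linarith)
    refine (measureReal_forall_exists_mem_le h.indep h.meas h.map_eq
      (fun r => measurableSet_strictDom _) (p := Real.exp (-t k))
      (q := Real.exp (-(t k * (1 + 1 / m)))) ?_ ?_ (Real.exp_nonneg _) _).trans ?_
    · intro r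
      rw [expVec_strictDom (simplexPoint_mem_orthant ht0 r), coordSum_simplexPoint]
    · intro r s hrs
      have hinter : {y | StrictDom (simplexPoint d m (t k) r) y} ∩
          {y | StrictDom (simplexPoint d m (t k) s) y} =
          {y | StrictDom (simplexPoint d m (t k) r ⊔ simplexPoint d m (t k) s) y} := by
        ext y
        simp [StrictDom, forall_and]
      have hmem : simplexPoint d m (t k) r ⊔ simplexPoint d m (t k) s ∈ orthant (d + 2) :=
        fun j => (simplexPoint_mem_orthant ht0 r j).trans le_sup_left
      rw [hinter, expVec_strictDom hmem]
      exact Real.exp_le_exp.2 (neg_le_neg (le_coordSum_sup_simplexPoint ht0 hrs))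
    · push_cast
      rw [pow_zero, one_mul, Real.rpow_one, ← neg_mul c, Real.rpow_mul_natCast (Nat.cast_nonneg k), ← h1]
      refine add_le_add le_rfl (mul_le_mul_of_nonneg_left ?_ (by positivity))
      calc (2 : ℝ) ^ k * Real.exp (-(t k * (1 + 1 / m)))
          = (2 : ℝ) ^ k * Real.exp (-t k) * Real.exp (-(t k / m)) := by
            rw [mul_assoc, ← Real.exp_add]; ring_nf
        _ ≤ 1 * Real.exp (-(Real.log 2 / m * k)) := by
            rw [← h1] at h2
            refine mul_le_mul h2 (Real.exp_le_exp.2 (neg_le_neg ?_)) (Real.exp_nonneg _) zero_le_one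
            calc Real.log 2 / m * k = k * Real.log 2 / m := by ring
              _ ≤ _ := by gcongr
        _ = _ := one_mul _
  have hs : Summable fun k : ℕ => (k : ℝ) ^ (-(c * m)) +
      m ^ 2 * (((k : ℝ) + 1) ^ 0 * Real.exp (-(Real.log 2 / m * (k : ℝ) ^ (1 : ℝ)))) :=
    (Real.summable_nat_rpow.2 (by linarith)).add
      ((summable_mul_exp_neg_rpow 0 (by positivity) one_pos).mul_left _)
  filter_upwards [ae_eventually_notMem_of_summable hB hs] with ω hω
  filter_upwards [hω, eventually_ge_atTop 1] with k hk hk1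
  by_contra! hlt
  apply hk
  have hk0 : (1 : ℝ) ≤ k := by exact_mod_cast hk1
  have ht0 : 0 ≤ t k := add_nonneg (by positivity) (mul_nonneg hc.le (Real.log_nonneg hk0))
  intro r
  by_contra! hr
  have hmem : simplexPoint d m (t k) r ∈ recordRegion (fun i => X i ω) (2 ^ k) :=
    ⟨simplexPoint_mem_orthant ht0 r, hr⟩
  have := frontierMin_le (by omega) (h.pos ω) Nat.one_le_two_pow hmem
  rw [coordSum_simplexPoint] at this
  exact absurd this (not_le.2 hlt)

/-- At least `C * k ^ (d - c)` exceedances are expected among `2 ^ k` observations, so having none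
has summable probability. Here `d` is the dimension minus one. -/
lemma IsExpSample.ae_eventually_le_frontierMax {d : ℕ} {X : ℕ → Ω → Fin (d + 1) → ℝ}
    (h : IsExpSample P X) {c : ℝ} (hc0 : 0 ≤ c) (hc : c < d) :
    ∀ᵐ ω ∂P, ∀ᶠ k : ℕ in atTop,
      k * Real.log 2 + c * Real.log k ≤ frontierMax (fun i => X i ω) (2 ^ k) := by
  obtain ⟨C, hC, hCle⟩ := exists_le_mul_tail d
  let t : ℕ → ℝ := fun k => k * Real.log 2 + c * Real.log k
  let B : ℕ → Set Ω := fun k => {ω | ∀ i < 2 ^ k, X i ω ∉ {y | t k < coordSum y}}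
  have hB : ∀ᶠ k : ℕ in atTop, P.real (B k) ≤
      ((k : ℝ) + 1) ^ 0 * Real.exp (-(C * (k : ℝ) ^ ((d : ℝ) - c))) := by
    filter_upwards [eventually_ge_atTop 1] with k hk
    have hk0 : (1 : ℝ) ≤ k := by exact_mod_cast hk
    refine (measureReal_forall_notMem_le h.indep h.meas h.map_eq
      (measurableSet_lt_coordSum _) _).trans ?_
    rw [pow_zero, one_mul]
    refine Real.exp_le_exp.2 (neg_le_neg ?_)
    have := hCle (2 ^ k) k c (one_le_pow₀ one_le_two) hk0 hc0 (by
      rw [Real.log_pow]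
      have := Real.log_two_gt_d9
      nlinarith)
    rw [Real.log_pow] at this
    exact_mod_cast this
  filter_upwards [ae_eventually_notMem_of_summable hB
    (summable_mul_exp_neg_rpow 0 hC (sub_pos.2 hc))] with ω hω
  filter_upwards [hω] with k hk
  by_contra! hlt
  refine hk fun i hi hmem => ?_
  have := coordSum_le_frontierMax (by omega) (h.pos ω) hi
  exact absurd (this.trans_lt hlt) (not_lt.2 (le_of_lt hmem))

lemma IsExpSample.measureReal_lt_frontierMax_le {d : ℕ} {X : ℕ → Ω → Fin (d + 1) → ℝ}
    (h : IsExpSample P X) {c : ℝ} (hc0 : 0 ≤ c) {n : ℕ} (hn : 1 ≤ n) {y : ℝ} (hy : 1 ≤ y)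
    (hny : Real.log n ≤ y) :
    P.real {ω | Real.log n + c * Real.log y < frontierMax (fun i => X i ω) n} ≤
      (2 + c) ^ d * y ^ ((d : ℝ) - c) := by
  refine le_trans ?_ (mul_tail_le d (N := n) (by exact_mod_cast hn) hy hc0 hny)
  refine le_trans (measureReal_mono ?_) (measureReal_exists_mem_le h.meas h.map_eq
    (measurableSet_lt_coordSum _) n)
  intro ω hω
  obtain ⟨i, hi, hmax⟩ := exists_coordSum_eq_frontierMax (by omega) (h.pos ω) hn
  exact ⟨i, hi, lt_of_lt_of_eq hω hmax.symm⟩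

lemma IsExpSample.ae_eventually_frontierMax_le {d : ℕ} {X : ℕ → Ω → Fin (d + 1) → ℝ}
    (h : IsExpSample P X) {c : ℝ} (hc : (d : ℝ) + 1 < c) :
    ∀ᵐ ω ∂P, ∀ᶠ k : ℕ in atTop,
      frontierMax (fun i => X i ω) (2 ^ k) ≤ k * Real.log 2 + c * Real.log k := by
  have hd : (0 : ℝ) ≤ d := Nat.cast_nonneg d
  have hB : ∀ᶠ k : ℕ in atTop, P.real {ω | k * Real.log 2 + c * Real.log k <
      frontierMax (fun i => X i ω) (2 ^ k)} ≤ (2 + c) ^ d * (k : ℝ) ^ ((d : ℝ) - c) := by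
    filter_upwards [eventually_ge_atTop 1] with k hk
    have hk0 : (1 : ℝ) ≤ k := by exact_mod_cast hk
    have := h.measureReal_lt_frontierMax_le (c := c) (by linarith) (n := 2 ^ k)
      Nat.one_le_two_pow hk0 (by
        push_cast
        rw [Real.log_pow]
        have := Real.log_two_lt_d9
        nlinarith)
    push_cast at this
    rwa [Real.log_pow] at this
  filter_upwards [ae_eventually_notMem_of_summable hB
    ((Real.summable_nat_rpow.2 (by linarith)).mul_left _)] with ω hω
  filter_upwards [hω] with k hk
  exact not_lt.1 hk

/-- The union bound `(log n) ^ (d - c)` only has to vanish here, not be summable along powers of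
two; hence `d < c` instead of `d + 1 < c`. -/
lemma IsExpSample.tendsto_measure_frontierMax {d : ℕ} {X : ℕ → Ω → Fin (d + 1) → ℝ}
    (h : IsExpSample P X) {c : ℝ} (hc : (d : ℝ) < c) :
    Tendsto (fun n : ℕ => P {ω | c < (frontierMax (fun i => X i ω) n - Real.log n) /
      Real.log (Real.log n)}) atTop (𝓝 0) := by
  have hd : (0 : ℝ) ≤ d := Nat.cast_nonneg d
  have h0 : Tendsto (fun n : ℕ => (2 + c) ^ d * Real.log n ^ ((d : ℝ) - c)) atTop (𝓝 0) := by
    have := (tendsto_rpow_neg_atTop (sub_pos.2 hc)).comp tendsto_log_nat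
    simpa [Function.comp_def] using this.const_mul ((2 + c) ^ d)
  have h1 := ENNReal.tendsto_ofReal h0
  rw [ENNReal.ofReal_zero] at h1
  refine tendsto_of_tendsto_of_tendsto_of_le_of_le' tendsto_const_nhds h1
    (Eventually.of_forall fun _ => zero_le) ?_
  filter_upwards [eventually_ge_atTop 1, tendsto_log_nat.eventually_ge_atTop 1,
    tendsto_log_log_nat.eventually_gt_atTop 0] with n hn hl hll
  have hc0 : 0 ≤ c := hd.trans hc.le
  rw [ENNReal.le_ofReal_iff_toReal_le (measure_ne_top _ _) (by positivity), ← measureReal_def]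
  refine le_trans (measureReal_mono ?_)
    (h.measureReal_lt_frontierMax_le (by linarith) hn hl le_rfl)
  intro ω hω
  have := (lt_div_iff₀ hll).1 hω
  simp only [Set.mem_ofPred_eq]
  linarith

lemma IsExpSample.ae_frequently_le_frontierMax {d : ℕ} {X : ℕ → Ω → Fin (d + 1) → ℝ}
    (h : IsExpSample P X) :
    ∀ᵐ ω ∂P, ∃ᶠ n : ℕ in atTop, (d : ℝ) + 1 ≤
      (frontierMax (fun i => X i ω) n - Real.log n) / Real.log (Real.log n) := by
  obtain ⟨C, hC, hCle⟩ := exists_le_mul_tail d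
  -- Observation `X n` is the `(n + 1)`-st, so it is compared with the level for sample size `n +
  -- 1`. The coefficient `d + 1` makes its exceedance probability at least of order `1 / (n log n)`,
  -- the divergent borderline.
  let A : ℕ → Set (Fin (d + 1) → ℝ) := fun n =>
    {y | Real.log (n + 1 : ℕ) + (d + 1) * Real.log (Real.log (n + 1 : ℕ)) < coordSum y}
  have hns : ¬ Summable fun n => (expVec (d + 1)).real (A n) := by
    intro hs
    have hs' : Summable fun n : ℕ => C * (((n + 1 : ℕ) : ℝ) * Real.log (n + 1 : ℕ))⁻¹ := by
      refine Summable.of_norm_bounded_eventually_nat hs ?_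
      filter_upwards [(tendsto_log_nat.comp (tendsto_add_atTop_nat 1)).eventually_ge_atTop 1]
        with n hn
      simp only [Function.comp_def] at hn
      have hn0 : (0 : ℝ) < (n + 1 : ℕ) := by positivity
      have := hCle (n + 1 : ℕ) (Real.log (n + 1 : ℕ)) (d + 1) (by norm_num) hn (by positivity)
        (by linarith)
      rw [sub_add_cancel_left, Real.rpow_neg_one] at this
      rw [Real.norm_of_nonneg (by positivity), mul_inv, mul_left_comm, ← div_eq_inv_mul,
        div_le_iff₀ hn0, mul_comm _ ((n + 1 : ℕ) : ℝ)]
      exact this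
    rw [summable_mul_left_iff hC.ne',
      summable_nat_add_iff (f := fun n : ℕ => ((n : ℝ) * Real.log n)⁻¹) 1] at hs'
    exact not_summable_inv_nat_mul_log hs'
  filter_upwards [ae_frequently_mem_of_not_summable h.indep h.meas h.map_eq
    (fun n => measurableSet_lt_coordSum _) hns] with ω hω
  refine (tendsto_add_atTop_nat 1).frequently ?_
  refine (hω.and_eventually ((tendsto_log_log_nat.comp
    (tendsto_add_atTop_nat 1)).eventually_gt_atTop 0)).mono ?_
  rintro n ⟨hn, hpos⟩
  simp only [Function.comp_def] at hpos
  rw [le_div_iff₀ hpos]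
  have h1 := coordSum_le_frontierMax (by omega) (h.pos ω) (Nat.lt_succ_self n)
  have h2 : Real.log (n + 1 : ℕ) + (d + 1) * Real.log (Real.log (n + 1 : ℕ)) < coordSum (X n ω) := hn
  linarith

end Sample

/-! ### Limits of the normalised width. -/

section Width

lemma liminf_coe_ereal_eq {w : ℕ → ℝ} {a : ℝ} (h1 : ∀ ε > 0, ∀ᶠ n in atTop, a - ε ≤ w n)
    (h2 : ∀ ε > 0, ∃ᶠ n in atTop, w n ≤ a + ε) :
    liminf (fun n => (w n : EReal)) atTop = (a : EReal) := by
  refine le_antisymm (EReal.le_of_forall_lt_iff_le.1 fun z hz => ?_)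
    (EReal.ge_of_forall_gt_iff_ge.1 fun z hz => ?_)
  · rw [EReal.coe_lt_coe_iff] at hz
    refine liminf_le_of_frequently_le' ((h2 (z - a) (sub_pos.2 hz)).mono fun n hn => ?_)
    exact EReal.coe_le_coe_iff.2 (by linarith)
  · rw [EReal.coe_lt_coe_iff] at hz
    refine le_liminf_of_le (by isBoundedDefault) ((h1 (a - z) (sub_pos.2 hz)).mono fun n hn => ?_)
    exact EReal.coe_le_coe_iff.2 (by linarith)

lemma limsup_coe_ereal_eq {w : ℕ → ℝ} {a : ℝ} (h1 : ∀ ε > 0, ∀ᶠ n in atTop, w n ≤ a + ε)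
    (h2 : ∀ ε > 0, ∃ᶠ n in atTop, a - ε ≤ w n) :
    limsup (fun n => (w n : EReal)) atTop = (a : EReal) := by
  refine le_antisymm (EReal.le_of_forall_lt_iff_le.1 fun z hz => ?_)
    (EReal.ge_of_forall_gt_iff_ge.1 fun z hz => ?_)
  · rw [EReal.coe_lt_coe_iff] at hz
    refine limsup_le_of_le (by isBoundedDefault) ((h1 (z - a) (sub_pos.2 hz)).mono fun n hn => ?_)
    exact EReal.coe_le_coe_iff.2 (by linarith)
  · rw [EReal.coe_lt_coe_iff] at hz
    refine le_limsup_of_frequently_le' ((h2 (a - z) (sub_pos.2 hz)).mono fun n hn => ?_)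
    exact EReal.coe_le_coe_iff.2 (by linarith)

variable {Ω : Type*} [MeasurableSpace Ω] {P : Measure Ω} {d : ℕ}

/-- Monotonicity reduces to the countably many `ε = 1 / (m + 1)`. Offering `ε ≤ 1` keeps
coefficients such as `d + 1 - ε / 2` nonnegative. -/
lemma ae_forall_pos_of_antitone {p : ℝ → Ω → Prop} (hp : ∀ ε δ ω, ε ≤ δ → p ε ω → p δ ω)
    (h : ∀ ε, 0 < ε → ε ≤ 1 → ∀ᵐ ω ∂P, p ε ω) : ∀ᵐ ω ∂P, ∀ ε > 0, p ε ω := by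
  have : ∀ᵐ ω ∂P, ∀ m : ℕ, p (1 / ((m : ℝ) + 1)) ω :=
    ae_all_iff.2 fun m => h _ Nat.one_div_pos_of_nat
      (div_le_one_of_le₀ (by linarith [Nat.cast_nonneg (α := ℝ) m]) (by positivity))
  filter_upwards [this] with ω hω ε hε
  obtain ⟨m, hm⟩ := exists_nat_one_div_lt hε
  exact hp _ _ _ hm.le (hω m)

/-- A sample of vectors with independent Exponential(1) coordinates agrees almost surely with a
measurable one whose coordinates are everywhere positive. -/
lemma exists_isExpSample {X : ℕ → Ω → Fin d → ℝ} (hindep : iIndepFun X P)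
    (hlaw : ∀ i, HasLaw (X i) (expVec d) P) :
    ∃ Y : ℕ → Ω → Fin d → ℝ, IsExpSample P Y ∧ ∀ i, X i =ᵐ[P] Y i := by
  classical
  let Z : ℕ → Ω → Fin d → ℝ := fun i => (hlaw i).aemeasurable.mk (X i)
  let Q : Set (Fin d → ℝ) := {y | ∀ j, 0 < y j}
  have hQ : MeasurableSet Q := measurableSet_strictDom 0
  have hZ : ∀ i, Measurable (Z i) := fun i => (hlaw i).aemeasurable.measurable_mk
  let Y : ℕ → Ω → Fin d → ℝ := fun i ω => if Z i ω ∈ Q then Z i ω else 1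
  have hY : ∀ i, Measurable (Y i) := fun i =>
    Measurable.ite (hZ i hQ) (hZ i) measurable_const
  have hXY : ∀ i, X i =ᵐ[P] Y i := by
    intro i
    have hpos : ∀ᵐ ω ∂P, X i ω ∈ Q := by
      refine ae_of_ae_map (hlaw i).aemeasurable ?_
      rw [(hlaw i).map_eq]
      exact ae_expVec_pos
    filter_upwards [(hlaw i).aemeasurable.ae_eq_mk, hpos] with ω h1 h2
    have h3 : Z i ω = X i ω := h1.symm
    simp only [Y, h3, if_pos h2]
  refine ⟨Y, ⟨hindep.congr hXY, hY, fun i => ?_, fun ω i j => ?_⟩, hXY⟩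
  · rw [← (hlaw i).map_eq]
    exact Measure.map_congr (hXY i).symm
  · by_cases hω : Z i ω ∈ Q
    · simpa only [Y, if_pos hω] using hω j
    · simp [Y, if_neg hω]

variable [IsProbabilityMeasure P]

lemma IsExpSample.ae_tendsto_frontierMin {X : ℕ → Ω → Fin (d + 2) → ℝ} (h : IsExpSample P X) :
    ∀ᵐ ω ∂P, Tendsto (fun n : ℕ => (frontierMin (fun i => X i ω) n - Real.log n) /
      Real.log (Real.log n)) atTop (𝓝 0) := by
  have hmono : ∀ ω m n, 1 ≤ m → m ≤ n →
      frontierMin (fun i => X i ω) m ≤ frontierMin (fun i => X i ω) n :=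
    fun ω m n => frontierMin_mono (by omega) (h.pos ω)
  have key : ∀ᵐ ω ∂P, ∀ ε > 0, ∀ᶠ n : ℕ in atTop,
      |(frontierMin (fun i => X i ω) n - Real.log n) / Real.log (Real.log n)| ≤ ε := by
    refine ae_forall_pos_of_antitone (fun ε δ ω hεδ hp => hp.mono fun n hn => hn.trans hεδ)
      fun ε hε _ => ?_
    filter_upwards [h.ae_eventually_le_frontierMin (by omega) (half_pos hε),
      h.ae_eventually_frontierMin_le (half_pos hε)] with ω h1 h2
    filter_upwards [eventually_le_of_dyadic (hmono ω) (show -ε < -(ε / 2) by linarith) h1,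
      eventually_ge_of_dyadic (hmono ω) (show ε / 2 < ε by linarith) h2] with n h3 h4
    exact abs_le.2 ⟨h3, h4⟩
  filter_upwards [key] with ω hω
  rw [Metric.tendsto_atTop']
  intro ε hε
  obtain ⟨N, hN⟩ := eventually_atTop.1 (hω (ε / 2) (half_pos hε))
  refine ⟨N, fun n hn => ?_⟩
  rw [Real.dist_eq, sub_zero]
  linarith [hN n hn.le]

lemma IsExpSample.ae_forall_eventually_le_frontierMax {X : ℕ → Ω → Fin (d + 2) → ℝ}
    (h : IsExpSample P X) :
    ∀ᵐ ω ∂P, ∀ ε > 0, ∀ᶠ n : ℕ in atTop, (d : ℝ) + 1 - ε ≤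
      (frontierMax (fun i => X i ω) n - Real.log n) / Real.log (Real.log n) := by
  refine ae_forall_pos_of_antitone (fun ε δ ω hεδ hp => hp.mono fun n hn => by linarith)
    fun ε hε hε1 => ?_
  have hd : (0 : ℝ) ≤ d := Nat.cast_nonneg d
  filter_upwards [h.ae_eventually_le_frontierMax (c := d + 1 - ε / 2) (by linarith)
    (by push_cast; linarith)] with ω h1
  exact eventually_le_of_dyadic (fun m n => frontierMax_mono (by omega) (h.pos ω))
    (by linarith) h1

lemma IsExpSample.ae_forall_eventually_frontierMax_le {X : ℕ → Ω → Fin (d + 1) → ℝ}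
    (h : IsExpSample P X) :
    ∀ᵐ ω ∂P, ∀ ε > 0, ∀ᶠ n : ℕ in atTop,
      (frontierMax (fun i => X i ω) n - Real.log n) / Real.log (Real.log n) ≤ (d : ℝ) + 1 + ε := by
  refine ae_forall_pos_of_antitone (fun ε δ ω hεδ hp => hp.mono fun n hn => by linarith)
    fun ε hε hε1 => ?_
  filter_upwards [h.ae_eventually_frontierMax_le (c := d + 1 + ε / 2) (by linarith)] with ω h1
  exact eventually_ge_of_dyadic (fun m n => frontierMax_mono (by omega) (h.pos ω))
    (by linarith) h1

lemma frontierWidth_div_eq {m : ℕ} (x : ℕ → Fin m → ℝ) (n : ℕ) :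
    frontierWidth x n / Real.log (Real.log n) =
      (frontierMax x n - Real.log n) / Real.log (Real.log n) -
        (frontierMin x n - Real.log n) / Real.log (Real.log n) := by
  rw [frontierWidth, ← sub_div, sub_sub_sub_cancel_right]

/-- Only upward excursions of `F_n^+` prevent almost sure convergence. Truncating its coefficient at
`d + 1` restores it, hence convergence in measure, and the truncation matters by more than `ε / 4`
with vanishing probability. -/
lemma IsExpSample.tendstoInMeasure_frontierWidth {X : ℕ → Ω → Fin (d + 2) → ℝ}
    (h : IsExpSample P X) :
    TendstoInMeasure P (fun (n : ℕ) ω => frontierWidth (fun i => X i ω) n /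
      Real.log (Real.log n)) atTop fun _ => (d : ℝ) + 1 := by
  let A : ℕ → Ω → ℝ := fun n ω =>
    (frontierMax (fun i => X i ω) n - Real.log n) / Real.log (Real.log n)
  let B : ℕ → Ω → ℝ := fun n ω =>
    (frontierMin (fun i => X i ω) n - Real.log n) / Real.log (Real.log n)
  let g : ℕ → Ω → ℝ := fun n ω => min (A n ω) (d + 1) - B n ω
  have hA : ∀ n, Measurable (A n) := by
    intro n
    -- At `n = 0` the denominator is `log (log 0) = 0`, so the quotient is the constant 0.
    rcases Nat.eq_zero_or_pos n with rfl | hn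
    · simp [A]
    · exact ((h.measurable_frontierMax (by omega) hn).sub_const _).div_const _
  have hBm : ∀ n, Measurable (B n) := by
    intro n
    rcases Nat.eq_zero_or_pos n with rfl | hn
    · simp [B]
    · exact ((h.measurable_frontierMin (by omega) hn).sub_const _).div_const _
  have hg : TendstoInMeasure P g atTop fun _ => (d : ℝ) + 1 := by
    refine tendstoInMeasure_of_tendsto_ae
      (fun n => (((hA n).min measurable_const).sub (hBm n)).aestronglyMeasurable) ?_
    filter_upwards [h.ae_tendsto_frontierMin, h.ae_forall_eventually_le_frontierMax] with ω hB hA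
    have h1 : Tendsto (fun n => min (A n ω) ((d : ℝ) + 1)) atTop (𝓝 (d + 1)) := by
      refine tendsto_order.2 ⟨fun a ha => ?_, fun a ha => ?_⟩
      · filter_upwards [hA ((d + 1 - a) / 2) (by linarith)] with n hn
        refine lt_min (lt_of_lt_of_le ?_ hn) ha
        linarith
      · exact Eventually.of_forall fun n => (min_le_right _ _).trans_lt ha
    simpa [g] using h1.sub hB
  rw [tendstoInMeasure_iff_dist] at hg ⊢
  intro ε hε
  have h1 := (hg (ε / 2) (half_pos hε)).add
    (h.tendsto_measure_frontierMax (c := d + 1 + ε / 4) (by push_cast; linarith))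
  rw [add_zero] at h1
  refine tendsto_of_tendsto_of_tendsto_of_le_of_le tendsto_const_nhds h1
    (fun _ => zero_le) fun n => ?_
  refine (measure_mono ?_).trans (measure_union_le _ _)
  intro ω hω
  by_cases hlt : (d : ℝ) + 1 + ε / 4 < A n ω
  · exact Or.inr hlt
  · left
    have h2 : ε ≤ |A n ω - B n ω - (d + 1)| := by
      have h3 : ε ≤ dist (frontierWidth (fun i => X i ω) n / Real.log (Real.log n)) (d + 1) := hω
      rwa [Real.dist_eq, frontierWidth_div_eq] at h3
    change ε / 2 ≤ dist (g n ω) _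
    rw [Real.dist_eq]
    have h3 : |A n ω - min (A n ω) (d + 1)| ≤ ε / 4 := by
      rw [abs_of_nonneg (sub_nonneg.2 (min_le_left _ _)), sub_le_iff_le_add, ← min_add_add_left]
      exact le_min (by linarith) (by linarith)
    have h4 : A n ω - B n ω - (d + 1) =
        (g n ω - (d + 1)) + (A n ω - min (A n ω) (d + 1)) := by
      simp only [g]; ring
    rw [h4] at h2
    linarith [abs_add_le (g n ω - (d + 1)) (A n ω - min (A n ω) (d + 1))]

lemma IsExpSample.ae_frontierWidth {X : ℕ → Ω → Fin (d + 2) → ℝ} (h : IsExpSample P X) :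
    ∀ᵐ ω ∂P,
      liminf (fun n : ℕ => ((frontierWidth (fun i => X i ω) n / Real.log (Real.log n) : ℝ) :
        EReal)) atTop = (((d : ℝ) + 1 : ℝ) : EReal) ∧
      limsup (fun n : ℕ => ((frontierWidth (fun i => X i ω) n / Real.log (Real.log n) : ℝ) :
        EReal)) atTop = (((d : ℝ) + 2 : ℝ) : EReal) ∧
      (fun n : ℕ => frontierWidth (fun i => X i ω) n)
        =Θ[atTop] (fun n : ℕ => Real.log (Real.log n)) := by
  -- Convergence in measure yields an almost surely convergent subsequence, which attains the
  -- liminf.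
  obtain ⟨ns, hns, hsub⟩ := h.tendstoInMeasure_frontierWidth.exists_seq_tendsto_ae
  filter_upwards [hsub, h.ae_tendsto_frontierMin, h.ae_forall_eventually_le_frontierMax,
    h.ae_forall_eventually_frontierMax_le, h.ae_frequently_le_frontierMax] with ω hs hB hlo hup hfr
  push_cast at hup hfr
  have hB' : ∀ ε > 0, ∀ᶠ n : ℕ in atTop,
      |(frontierMin (fun i => X i ω) n - Real.log n) / Real.log (Real.log n)| < ε := fun ε hε =>
    ((Metric.tendsto_nhds.1 hB) ε hε).mono fun n hn => by
      rwa [Real.dist_eq, sub_zero] at hn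
  have hlow : ∀ ε > 0, ∀ᶠ n : ℕ in atTop,
      (d : ℝ) + 1 - ε ≤ frontierWidth (fun i => X i ω) n / Real.log (Real.log n) := by
    intro ε hε
    filter_upwards [hB' (ε / 2) (half_pos hε), hlo (ε / 2) (half_pos hε)] with n h1 h2
    rw [frontierWidth_div_eq]
    linarith [(abs_lt.1 h1).2]
  have hupp : ∀ ε > 0, ∀ᶠ n : ℕ in atTop,
      frontierWidth (fun i => X i ω) n / Real.log (Real.log n) ≤ (d : ℝ) + 2 + ε := by
    intro ε hε
    filter_upwards [hB' (ε / 2) (half_pos hε), hup (ε / 2) (half_pos hε)] with n h1 h2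
    rw [frontierWidth_div_eq]
    linarith [(abs_lt.1 h1).1]
  refine ⟨liminf_coe_ereal_eq hlow fun ε hε => ?_, limsup_coe_ereal_eq hupp fun ε hε => ?_, ?_, ?_⟩
  · refine hns.tendsto_atTop.frequently (Eventually.frequently ?_)
    exact ((tendsto_order.1 hs).2 _ (by linarith)).mono fun n hn => le_of_lt hn
  · refine (hfr.and_eventually (hB' ε hε)).mono ?_
    rintro n ⟨h1, h2⟩
    rw [frontierWidth_div_eq]
    linarith [(abs_lt.1 h2).2]
  · refine IsBigO.of_bound ((d : ℝ) + 3) ?_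
    filter_upwards [hlow (1 / 2) (by norm_num), hupp 1 one_pos,
      tendsto_log_log_nat.eventually_gt_atTop 0] with n h1 h2 hpos
    rw [le_div_iff₀ hpos] at h1
    rw [div_le_iff₀ hpos] at h2
    have hd : (0 : ℝ) ≤ d := Nat.cast_nonneg d
    rw [Real.norm_of_nonneg (by nlinarith), Real.norm_of_nonneg hpos.le]
    linarith
  -- The ratio is eventually at least `d + 1 - 1 / 2 ≥ 1 / 2`.
  · refine IsBigO.of_bound 2 ?_
    filter_upwards [hlow (1 / 2) (by norm_num),
      tendsto_log_log_nat.eventually_gt_atTop 0] with n h1 hpos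
    rw [le_div_iff₀ hpos] at h1
    have hd : (0 : ℝ) ≤ d := Nat.cast_nonneg d
    rw [Real.norm_of_nonneg hpos.le, Real.norm_of_nonneg (by nlinarith)]
    nlinarith

end Width

theorem theoremT {Ω : Type*} [MeasurableSpace Ω] (P : Measure Ω) [IsProbabilityMeasure P]
    (d : ℕ) (hd : 1 ≤ d) (X : ℕ → Ω → Fin d → ℝ)
    (hindep : iIndepFun X P)
    (hlaw : ∀ i, HasLaw (X i) (Measure.pi fun _ : Fin d => expMeasure 1) P) :
    (∀ᵐ ω ∂P, ∀ n : ℕ, 1 ≤ n →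
      IsLeast (coordSum '' recordFrontier (fun i => X i ω) n)
        (frontierMin (fun i => X i ω) n) ∧
      IsGreatest (coordSum '' recordFrontier (fun i => X i ω) n)
        (frontierMax (fun i => X i ω) n)) ∧
    TendstoInMeasure P
      (fun (n : ℕ) ω => frontierWidth (fun i => X i ω) n / Real.log (Real.log n))
      atTop (fun _ => (d : ℝ) - 1) ∧
    (2 ≤ d → ∀ᵐ ω ∂P,
      liminf (fun n : ℕ =>
        ((frontierWidth (fun i => X i ω) n / Real.log (Real.log n) : ℝ) : EReal)) atTop
        = (((d : ℝ) - 1 : ℝ) : EReal) ∧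
      limsup (fun n : ℕ =>
        ((frontierWidth (fun i => X i ω) n / Real.log (Real.log n) : ℝ) : EReal)) atTop
        = ((d : ℝ) : EReal) ∧
      (fun n : ℕ => frontierWidth (fun i => X i ω) n)
        =Θ[atTop] (fun n : ℕ => Real.log (Real.log n))) := by
  obtain ⟨Y, hY, hXY⟩ := exists_isExpSample hindep hlaw
  have hae : ∀ᵐ ω ∂P, (fun i => X i ω) = fun i => Y i ω := by
    filter_upwards [ae_all_iff.2 hXY] with ω hω
    exact funext hω
  refine ⟨?_, ?_, fun h2 => ?_⟩
  · filter_upwards [hae] with ω hω n hn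
    rw [hω]
    exact ⟨isLeast_frontierMin hd (hY.pos ω) hn, isGreatest_frontierMax hd (hY.pos ω) hn⟩
  · refine TendstoInMeasure.congr_left
      (f := fun (n : ℕ) ω => frontierWidth (fun i => Y i ω) n / Real.log (Real.log n))
      (fun n => ?_) ?_
    · filter_upwards [hae] with ω hω
      rw [hω]
    -- In dimension one the width is identically 0, in agreement with the limit `d - 1`.
    · match d, hd with
      | 1, _ =>
        intro ε hε
        refine tendsto_const_nhds.congr' ?_
        filter_upwards [eventually_ge_atTop 1] with n hn
        simp [frontierWidth_dim_one (hY.pos _) hn, hε.ne']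
      | d + 2, _ =>
        have := hY.tendstoInMeasure_frontierWidth
        convert this using 2
        push_cast
        ring
  · obtain ⟨d, rfl⟩ := Nat.exists_eq_add_of_le' h2
    filter_upwards [hae, hY.ae_frontierWidth] with ω hω h
    rw [hω]
    have hd1 : ((d + 2 : ℕ) : ℝ) - 1 = d + 1 := by push_cast; ring
    have hd2 : ((d + 2 : ℕ) : ℝ) = d + 2 := by push_cast; ring
    rw [hd1, hd2]
    exact h
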